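/- **Conventions.** Let $Y$ be a regular $F$-finite scheme of prime characteristic $p$ and $\mathfrak a$ a coherent ideal sheaf on $Y$ that is everywhere nonzero (its restriction to every connected component of $Y$ is nonzero). If $Y=\operatorname{Spec}R$ is affine, then for an ideal $J$ and $e\ge 0$ let $J^{[p^e]}=(h^{p^e}\mid h\in J)$, and for an ideal $\mathfrak b$ let $\mathfrak b^{[1/p^e]}$ be the smallest ideal $J$ with $\mathfrak b\subseteq J^{[p^e]}$. For real $t\ge 0$ the test ideal $\tau(\mathfrak a^{t})$ is the ideal $(\mathfrak a^{\lceil tp^e\rceil})^{[1/p^e]}$ for $e\gg 0$ (it does not depend on $e\gg0$). This construction commutes with localization, so it defines a coherent ideal sheaf $\tau(\mathfrak a^{t})$ on a general $Y$. A real number $t>0$ is an *$F$-jumping number* of $\mathfrak a$ if $\tau(\mathfrak a^{t})\neq\tau(\mathfrak a^{\mu})$ for every $0\le\mu<t$. **Theorem.** Let $\lambda\in\mathbb Q_{>0}$. There is a positive integer $p_0=p_0(\lambda)$, depending only on $\lambda$, with the following property. Let $A$ be a nonzero finitely generated $\mathbb Z$-algebra, let $X$ be a scheme of finite type over $\operatorname{Spec}A$,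 smooth of relative dimension $n$, and let $\mathfrak a$ be a locally principal (coherent) ideal sheaf on $X$ whose restriction $\mathfrak a_s=\mathfrak a\cdot\mathcal O_{X_s}$ to every fiber $X_s$, $s\in\operatorname{Spec}A$, is everywhere nonzero. Then there is a positive integer $N$ such that: 1. for every closed point $s\in\operatorname{Spec}A$ with $\operatorname{char}(k(s))>p_0$ and every $F$-jumping number $\mu<\lambda$ of $\mathfrak a_s$, $$\lambda-\mu\ \ge\ \frac{1}{\operatorname{char}(k(s))^{N}};$$ 2. for some $a\in A$ that is not nilpotent, the same inequality, with the same $N$, holds for every closed point $s\in\operatorname{Spec}A_a\subseteq\operatorname{Spec}A$ and every $F$-jumping number $\mu<\lambda$ of $\mathfrak a_s$. -/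

import Mathlib

open CategoryTheory AlgebraicGeometry

universe u

noncomputable section

/-! ### Test ideals in a regular, `F`-finite ring of characteristic `p` -/

/-- The Frobenius power `J^{[p^e]} = (h^{p^e} | h ∈ J)` of an ideal `J`. -/
def frobeniusPow {R : Type*} [CommRing R] (p e : ℕ) (J : Ideal R) : Ideal R :=
  Ideal.span {x | ∃ h ∈ J, x = h ^ (p ^ e)}

/-- The ideal `𝔟^{[1/p^e]}`: the smallest ideal `J` such that `𝔟 ⊆ J^{[p^e]}`. It is written as
the intersection of all such `J`; in a regular `F`-finite ring of characteristic `p` the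
intersection is itself such a `J`. -/
def frobeniusRoot {R : Type*} [CommRing R] (p e : ℕ) (𝔟 : Ideal R) : Ideal R :=
  sInf {J | 𝔟 ≤ frobeniusPow p e J}

/-- Whenever there is a smallest ideal `J` with `𝔟 ⊆ J^{[p^e]}`, it is `frobeniusRoot p e 𝔟`. -/
theorem frobeniusRoot_eq_of_isLeast {R : Type*} [CommRing R] {p e : ℕ} {𝔟 J : Ideal R}
    (h : IsLeast {J | 𝔟 ≤ frobeniusPow p e J} J) : frobeniusRoot p e 𝔟 = J :=
  h.isGLB.sInf_eq

/-- The test ideal `τ(𝔞^t)`, the ideal `(𝔞^{⌈t p^e⌉})^{[1/p^e]}` for `e ≫ 0`. The stable value of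
the sequence is written as its lower limit in the complete lattice of ideals. -/
def ringTestIdeal {R : Type*} [CommRing R] (p : ℕ) (𝔞 : Ideal R) (t : ℝ) : Ideal R :=
  Filter.liminf (fun e : ℕ => frobeniusRoot p e (𝔞 ^ ⌈t * (p : ℝ) ^ e⌉₊)) Filter.atTop

/-- If the sequence of ideals is constant for `e ≫ 0`, then `ringTestIdeal` is its stable value. -/
theorem ringTestIdeal_eq_of_eventually {R : Type*} [CommRing R] {p : ℕ} {𝔞 J : Ideal R} {t : ℝ}
    (h : ∀ᶠ e : ℕ in Filter.atTop, frobeniusRoot p e (𝔞 ^ ⌈t * (p : ℝ) ^ e⌉₊) = J) :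
    ringTestIdeal p 𝔞 t = J := by
  unfold ringTestIdeal
  rw [Filter.liminf_congr h, Filter.liminf_const]

/-! ### Test ideals and `F`-jumping numbers on schemes -/

/-- The test ideal sheaf `τ(𝔞^t)` of an ideal sheaf `𝔞` on a regular `F`-finite scheme of
characteristic `p`: the ideal sheaf whose value on an affine open `U` is the test ideal of
`𝔞(U)`. (On a regular `F`-finite scheme, test ideals commute with localization, so that these
ideals form an ideal sheaf, and `ofIdeals` returns it.) -/
def testIdeal {Y : Scheme.{u}} (p : ℕ) (𝔞 : Y.IdealSheafData) (t : ℝ) : Y.IdealSheafData :=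
  Scheme.IdealSheafData.ofIdeals fun U => ringTestIdeal p (𝔞.ideal U) t

/-- If the test ideals on the affine opens form an ideal sheaf, then `testIdeal` is that sheaf. -/
theorem testIdeal_eq_of_ideal_eq {Y : Scheme.{u}} {p : ℕ} {𝔞 J : Y.IdealSheafData} {t : ℝ}
    (h : ∀ U : Y.affineOpens, J.ideal U = ringTestIdeal p (𝔞.ideal U) t) :
    testIdeal p 𝔞 t = J := by
  unfold testIdeal
  rw [← funext h, Scheme.IdealSheafData.ofIdeals_ideal]

/-- `t > 0` is an `F`-jumping number of `𝔞` if `τ(𝔞^t) ≠ τ(𝔞^μ)` for every `0 ≤ μ < t`. -/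
def IsFJumpingNumber {Y : Scheme.{u}} (p : ℕ) (𝔞 : Y.IdealSheafData) (t : ℝ) : Prop :=
  0 < t ∧ ∀ μ : ℝ, 0 ≤ μ → μ < t → testIdeal p 𝔞 t ≠ testIdeal p 𝔞 μ

/-! ### Ideal sheaves and their restrictions to the fibers of a family -/

/-- An ideal sheaf is locally principal if every point has an affine open neighborhood on which
it is generated by one section. -/
def IsLocallyPrincipal {X : Scheme.{u}} (𝔞 : X.IdealSheafData) : Prop :=
  ∀ x : X, ∃ U : X.affineOpens, x ∈ U.1 ∧ (𝔞.ideal U).IsPrincipal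

/-- An ideal sheaf on a locally Noetherian scheme (whose connected components are open) is
everywhere nonzero if its restriction to every connected component is nonzero. -/
def IsEverywhereNonzero {Y : Scheme.{u}} (𝔞 : Y.IdealSheafData) : Prop :=
  ∀ y : Y, ∃ U : Y.affineOpens, (U.1 : Set Y) ⊆ connectedComponent y ∧ 𝔞.ideal U ≠ ⊥

/-- The ideal sheaf `𝔞_s = 𝔞 · 𝒪_{X_s}` on the scheme-theoretic fiber `X_s` of `π` over `s`. -/
def fiberIdeal {X S : Scheme.{u}} (π : X ⟶ S) (𝔞 : X.IdealSheafData) (s : S) :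
    (π.fiber s).IdealSheafData :=
  𝔞.comap (π.fiberι s)

/-- The characteristic of the residue field `k(s)`. -/
def residueChar {S : Scheme.{u}} (s : S) : ℕ :=
  ringChar (S.residueField s)

/-- The estimate at the point `s`: every `F`-jumping number `μ < l` of `𝔞_s` satisfies
`l - μ ≥ 1 / char(k(s))^N`. -/
def JumpingGapAt {X S : Scheme.{u}} (π : X ⟶ S) (𝔞 : X.IdealSheafData) (l : ℝ) (N : ℕ)
    (s : S) : Prop :=
  ∀ μ : ℝ, IsFJumpingNumber (residueChar s) (fiberIdeal π 𝔞 s) μ → μ < l →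
    1 / (residueChar s : ℝ) ^ N ≤ l - μ

end

/-! For a principal ideal, τ(f^t) = τ(f^{pt})^{[1/p]} and τ(f^{t+1}) = f·τ(f^t), so jumping numbers
are stable under t ↦ pt and, above 1, under t ↦ t - 1. Let m be the denominator of λ, D = φ(m), and
let λ - δ be a jumping number. Multiplying by p^m and subtracting an integer gives a jumping number
b - p^m δ with b = r/m in (0, 1] and (p^D - 1)b an integer. Multiplying repeatedly by p^D and
subtracting that integer gives the jumping numbers b - p^{m+Di} δ. If δ < p^{-N}, this is a long
strictly decreasing sequence in (0, 1] (`IsRingJump.gap`).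

The length of such sequences is bounded independently of p. A chart of a fiber is a quotient of k[x]
by equations g_i with invertible Jacobian. Cartier operators on k[x] divide degrees by p; twisted by
∏ g_i^{p-1}, as in Fedder's criterion, they descend to the quotient
(`exists_isCartierFamily_of_jacobian`). Hence, for t ≤ 1, τ(f^t) is generated by images of
polynomials of degree at most d = deg f + ∑ deg g_i, and strict drops are counted by a space of
dimension at most the number of monomials of degree ≤ d (`not_strictAnti_isRingJump`).

The equations come from a chart over A, so d serves all its fibers; finitely many charts then give
one N for all points and all positive characteristics. The needed properties of test ideals all
follow from Cartier families, which take the place of freeness of Frobenius. -/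

/-! ### Frobenius powers of ideals -/

section FrobeniusPow

variable {R S : Type*} [CommRing R] [CommRing S] {p e : ℕ}

theorem pow_mem_frobeniusPow {J : Ideal R} {h : R} (hh : h ∈ J) :
    h ^ p ^ e ∈ frobeniusPow p e J :=
  Ideal.subset_span ⟨h, hh, rfl⟩

theorem frobeniusPow_mono {J K : Ideal R} (h : J ≤ K) : frobeniusPow p e J ≤ frobeniusPow p e K :=
  Ideal.span_mono fun _ ⟨a, ha, hx⟩ => ⟨a, h ha, hx⟩

theorem frobeniusPow_le_self (hp : p.Prime) (J : Ideal R) : frobeniusPow p e J ≤ J := by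
  refine Ideal.span_le.mpr ?_
  rintro _ ⟨h, hh, rfl⟩
  exact Ideal.pow_mem_of_mem _ hh _ (pow_pos hp.pos e)

/-- The condition `(p : R) = 0`, in place of `CharP R p`, admits the zero ring, which may occur as a
localization or as the sections over an empty open set. -/
theorem add_pow_prime_pow_of_natCast_eq_zero (hp : p.Prime) (hR : (p : R) = 0) (e : ℕ) (x y : R) :
    (x + y) ^ p ^ e = x ^ p ^ e + y ^ p ^ e := by
  induction e with
  | zero => simp
  | succ e ih =>
    obtain ⟨r, hr⟩ := exists_add_pow_prime_eq hp (x ^ p ^ e) (y ^ p ^ e)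
    rw [pow_succ, pow_mul, ih, hr, hR, pow_mul, pow_mul]
    simp

theorem frobeniusPow_span (hp : p.Prime) (hR : (p : R) = 0) (s : Set R) :
    frobeniusPow p e (Ideal.span s) = Ideal.span ((fun x => x ^ p ^ e) '' s) := by
  apply le_antisymm
  · refine Ideal.span_le.mpr ?_
    rintro _ ⟨h, hh, rfl⟩
    refine Submodule.span_induction (p := fun h _ => h ^ p ^ e ∈ Ideal.span ((fun x => x ^ p ^ e) '' s))
      ?_ ?_ ?_ ?_ hh
    · exact fun x hx => Ideal.subset_span ⟨x, hx, rfl⟩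
    · rw [zero_pow (pow_pos hp.pos e).ne']
      exact zero_mem _
    · intro x y _ _ hx hy
      rw [add_pow_prime_pow_of_natCast_eq_zero hp hR]
      exact add_mem hx hy
    · intro a x _ hx
      rw [smul_eq_mul, mul_pow]
      exact Ideal.mul_mem_left _ _ hx
  · refine Ideal.span_le.mpr ?_
    rintro _ ⟨h, hh, rfl⟩
    exact pow_mem_frobeniusPow (Ideal.subset_span hh)

theorem frobeniusPow_zero (J : Ideal R) : frobeniusPow p 0 J = J := by
  have : {x | ∃ h ∈ J, x = h ^ (p ^ 0)} = (J : Set R) := by ext; simp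
  rw [frobeniusPow, this, Ideal.span_eq]

theorem frobeniusPow_add (hp : p.Prime) (hR : (p : R) = 0) (a b : ℕ) (J : Ideal R) :
    frobeniusPow p (a + b) J = frobeniusPow p a (frobeniusPow p b J) := by
  have : frobeniusPow p b J = Ideal.span ((fun x => x ^ p ^ b) '' (J : Set R)) := by
    rw [← frobeniusPow_span hp hR, Ideal.span_eq]
  rw [this, frobeniusPow_span hp hR, Set.image_image, frobeniusPow]
  congr 1
  ext x
  simp [← pow_mul, ← pow_add, add_comm b a, eq_comm]

theorem map_frobeniusPow (hp : p.Prime) (hR : (p : R) = 0) (f : R →+* S) (J : Ideal R) :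
    (frobeniusPow p e J).map f = frobeniusPow p e (J.map f) := by
  have hS : (p : S) = 0 := by rw [← map_natCast f, hR, map_zero]
  have h1 : frobeniusPow p e J = Ideal.span ((fun x => x ^ p ^ e) '' (J : Set R)) := by
    rw [← frobeniusPow_span hp hR, Ideal.span_eq]
  rw [h1, Ideal.map_span, Ideal.map, frobeniusPow_span hp hS, Set.image_image, Set.image_image]
  simp

theorem frobeniusRoot_le {𝔟 K : Ideal R} (h : 𝔟 ≤ frobeniusPow p e K) : frobeniusRoot p e 𝔟 ≤ K :=
  sInf_le h

theorem frobeniusRoot_mono {𝔟 𝔠 : Ideal R} (h : 𝔟 ≤ 𝔠) :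
    frobeniusRoot p e 𝔟 ≤ frobeniusRoot p e 𝔠 :=
  sInf_le_sInf fun _ hJ => h.trans hJ

end FrobeniusPow

/-! ### Families of `p^{-e}`-linear maps that detect Frobenius powers -/

/-- A set of `p^{-e}`-linear endomorphisms of `R` that detects membership in the Frobenius powers
of ideals, as the coordinate functions do when `R` is free over itself through Frobenius. -/
structure IsCartierFamily {R : Type*} [CommRing R] (p e : ℕ) (Φ : Set (R →+ R)) : Prop where
  map_pow_mul : ∀ φ ∈ Φ, ∀ a x, φ (a ^ p ^ e * x) = a * φ x
  mem_of_forall : ∀ (K : Ideal R) (x : R), (∀ φ ∈ Φ, φ x ∈ K) → x ∈ frobeniusPow p e K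

/-- The `e`-fold compositions of members of `Φ`. -/
def iterateFamily {R : Type*} [CommRing R] (Φ : Set (R →+ R)) : ℕ → Set (R →+ R)
  | 0 => {AddMonoidHom.id R}
  | e + 1 => {χ | ∃ φ ∈ Φ, ∃ ψ ∈ iterateFamily Φ e, χ = ψ.comp φ}

namespace IsCartierFamily

variable {R S : Type*} [CommRing R] [CommRing S] {p e : ℕ} {Φ : Set (R →+ R)}

/-- A p^{-e}-linear φ sends r·h^{p^e} to φ(r)·h. The induction carries an arbitrary multiplier r
because φ is not R-linear. -/
theorem mem_iff (hΦ : IsCartierFamily p e Φ) {K : Ideal R} {x : R} :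
    x ∈ frobeniusPow p e K ↔ ∀ φ ∈ Φ, φ x ∈ K := by
  refine ⟨fun hx φ hφ => ?_, hΦ.mem_of_forall K x⟩
  rw [← one_mul x]
  refine Submodule.span_induction (p := fun x _ => ∀ r, φ (r * x) ∈ K) ?_ ?_ ?_ ?_ hx 1
  · rintro _ ⟨h, hh, rfl⟩ r
    rw [mul_comm, hΦ.map_pow_mul φ hφ]
    exact K.mul_mem_right _ hh
  · simp
  · intro x y _ _ hx hy r
    rw [mul_add, map_add]
    exact add_mem (hx r) (hy r)
  · intro a x _ hx r
    rw [smul_eq_mul, ← mul_assoc]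
    exact hx _

theorem frobeniusRoot_eq_span (hΦ : IsCartierFamily p e Φ) (𝔟 : Ideal R) :
    frobeniusRoot p e 𝔟 = Ideal.span {y | ∃ φ ∈ Φ, ∃ x ∈ 𝔟, y = φ x} := by
  refine frobeniusRoot_eq_of_isLeast ⟨fun x hx => hΦ.mem_iff.mpr fun φ hφ =>
    Ideal.subset_span ⟨φ, hφ, x, hx, rfl⟩, fun K hK => Ideal.span_le.mpr ?_⟩
  rintro _ ⟨φ, hφ, x, hx, rfl⟩
  exact hΦ.mem_iff.mp (hK hx) φ hφ

/-- Root and Frobenius power are adjoint; in particular the infimum defining the root is attained.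
-/
theorem frobeniusRoot_le_iff (hΦ : IsCartierFamily p e Φ) {𝔟 K : Ideal R} :
    frobeniusRoot p e 𝔟 ≤ K ↔ 𝔟 ≤ frobeniusPow p e K := by
  refine ⟨fun h x hx => hΦ.mem_iff.mpr fun φ hφ => h ?_, frobeniusRoot_le⟩
  rw [hΦ.frobeniusRoot_eq_span]
  exact Ideal.subset_span ⟨φ, hφ, x, hx, rfl⟩

theorem le_frobeniusPow_frobeniusRoot (hΦ : IsCartierFamily p e Φ) (𝔟 : Ideal R) :
    𝔟 ≤ frobeniusPow p e (frobeniusRoot p e 𝔟) :=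
  hΦ.frobeniusRoot_le_iff.mp le_rfl

theorem frobeniusRoot_span_singleton (hΦ : IsCartierFamily p e Φ) (b : R) :
    frobeniusRoot p e (Ideal.span {b}) = Ideal.span {y | ∃ φ ∈ Φ, y = φ b} := by
  refine frobeniusRoot_eq_of_isLeast ⟨?_, fun K hK => Ideal.span_le.mpr ?_⟩
  · rw [Set.mem_ofPred, Ideal.span_singleton_le_iff_mem]
    exact hΦ.mem_iff.mpr fun φ hφ => Ideal.subset_span ⟨φ, hφ, rfl⟩
  · rintro _ ⟨φ, hφ, rfl⟩
    exact hΦ.mem_iff.mp (hK (Ideal.mem_span_singleton_self b)) φ hφ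

theorem frobeniusRoot_span_pow_mul (hΦ : IsCartierFamily p e Φ) (f b : R) :
    frobeniusRoot p e (Ideal.span {f ^ p ^ e * b}) =
      Ideal.span {f} * frobeniusRoot p e (Ideal.span {b}) := by
  rw [hΦ.frobeniusRoot_span_singleton, hΦ.frobeniusRoot_span_singleton, Ideal.span_mul_span']
  congr 1
  ext y
  rw [Set.singleton_mul]
  constructor
  · rintro ⟨φ, hφ, rfl⟩
    exact ⟨φ b, ⟨φ, hφ, rfl⟩, (hΦ.map_pow_mul φ hφ _ _).symm⟩
  · rintro ⟨_, ⟨φ, hφ, rfl⟩, rfl⟩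
    exact ⟨φ, hφ, (hΦ.map_pow_mul φ hφ _ _).symm⟩

/-- Since x·φ(1) = φ(x^{p^e}) ∈ K for all φ, the unit 1 lies in (K : x)^{[p^e]} ⊆ (K : x). This
replaces the usual appeal to flatness of Frobenius. -/
theorem mem_of_pow_mem (hp : p.Prime) (hΦ : IsCartierFamily p e Φ) {K : Ideal R} {x : R}
    (hx : x ^ p ^ e ∈ frobeniusPow p e K) : x ∈ K := by
  have h1 : (1 : R) ∈ frobeniusPow p e (Submodule.comap (LinearMap.mulLeft R x) K : Ideal R) := by
    refine hΦ.mem_iff.mpr fun φ hφ => ?_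
    rw [Submodule.mem_comap, LinearMap.mulLeft_apply, ← hΦ.map_pow_mul φ hφ]
    exact hΦ.mem_iff.mp (Ideal.mul_mem_right _ _ hx) φ hφ
  simpa using frobeniusPow_le_self hp _ h1

theorem iterate (hp : p.Prime) (hR : (p : R) = 0) (hΦ : IsCartierFamily p 1 Φ) (e : ℕ) :
    IsCartierFamily p e (iterateFamily Φ e) := by
  induction e with
  | zero =>
    refine ⟨?_, fun K x hx => ?_⟩
    · rintro _ rfl a x
      simp
    · rw [frobeniusPow_zero]
      simpa using hx _ rfl
  | succ e ih =>
    refine ⟨?_, fun K x hx => ?_⟩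
    · rintro _ ⟨φ, hφ, ψ, hψ, rfl⟩ a x
      have := hΦ.map_pow_mul φ hφ (a ^ p ^ e) x
      rw [← pow_mul, ← pow_add] at this
      simp [this, ih.map_pow_mul ψ hψ]
    · rw [add_comm, frobeniusPow_add hp hR]
      exact hΦ.mem_of_forall _ _ fun φ hφ => ih.mem_of_forall _ _ fun ψ hψ =>
        hx _ ⟨φ, hφ, ψ, hψ, rfl⟩

/-! ### Localization of Cartier families -/

section Localization

variable [Algebra R S]

/-- Denominators can be taken to be p^e-th powers: x/m = x·m^{q-1}/m^q with q = p^e. -/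
theorem exists_mul_pow_eq_algebraMap (hp : p.Prime) (M : Submonoid R) [IsLocalization M S] (s : S) :
    ∃ x : R, ∃ m ∈ M, s * algebraMap R S m ^ p ^ e = algebraMap R S x := by
  obtain ⟨⟨x, m⟩, hx⟩ := IsLocalization.surj M s
  refine ⟨x * (m : R) ^ (p ^ e - 1), m, m.2, ?_⟩
  obtain ⟨n, hn⟩ : ∃ n, p ^ e = n + 1 := ⟨p ^ e - 1, by have := pow_pos hp.pos e; omega⟩
  simp only at hx
  rw [hn, Nat.add_sub_cancel, map_mul, map_pow, ← hx, pow_succ]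
  ring

/-- A `p^{-e}`-linear map extends to localizations. -/
theorem exists_extension (M : Submonoid R) [IsLocalization M S] {φ : R →+ R}
    (hφ : ∀ a x, φ (a ^ p ^ e * x) = a * φ x) (hp : p.Prime) :
    ∃ ψ : S →+ S, (∀ a x, ψ (a ^ p ^ e * x) = a * ψ x) ∧
      ∀ x, ψ (algebraMap R S x) = algebraMap R S (φ x) := by
  have hden := exists_mul_pow_eq_algebraMap (S := S) (e := e) hp M
  -- The extension is forced to be x/m^q ↦ φ(x)/m; the claim is that this value is independent of
  -- the fraction.
  have hval : ∀ s : S, ∃ y : S, ∀ x : R, ∀ m ∈ M,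
      s * algebraMap R S m ^ p ^ e = algebraMap R S x → y * algebraMap R S m =
        algebraMap R S (φ x) := by
    intro s
    obtain ⟨x₀, m₀, hm₀, h₀⟩ := hden s
    refine ⟨IsLocalization.mk' S (φ x₀) ⟨m₀, hm₀⟩, fun x m hm h => ?_⟩
    have h2 : algebraMap R S (m₀ ^ p ^ e * x) = algebraMap R S (m ^ p ^ e * x₀) := by
      rw [map_mul, map_mul, ← h₀, ← h, map_pow, map_pow]
      ring
    obtain ⟨c, hc⟩ := (IsLocalization.eq_iff_exists M S).mp h2
    -- Multiplying the relation by c^{q-1} turns c into c^q, which leaves φ as c.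
    have h3 : (c : R) * (m₀ * φ x) = c * (m * φ x₀) := by
      have := congrArg (fun z => φ ((c : R) ^ (p ^ e - 1) * z)) hc
      obtain ⟨n, hn⟩ : ∃ n, p ^ e = n + 1 := ⟨p ^ e - 1, by have := pow_pos hp.pos e; omega⟩
      have e1 : ∀ z : R, (c : R) ^ (p ^ e - 1) * (c * z) = c ^ p ^ e * z := by
        intro z; rw [hn, Nat.add_sub_cancel]; ring
      simpa only [e1, hφ] using this
    have h4 : algebraMap R S (m₀ * φ x) = algebraMap R S (m * φ x₀) :=
      (IsLocalization.eq_iff_exists M S).mpr ⟨c, h3⟩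
    rw [IsLocalization.mk'_eq_mul_mk'_one, mul_right_comm, ← map_mul, mul_comm (φ x₀), ← h4,
      map_mul, mul_comm (algebraMap R S m₀), mul_assoc]
    erw [IsLocalization.mk'_spec' S 1 (⟨m₀, hm₀⟩ : M)]
    simp
  choose ψ hψ using hval
  have huniq : ∀ (m : R), m ∈ M → ∀ y z : S, y * algebraMap R S m = z * algebraMap R S m → y = z :=
    fun m hm y z h => (IsLocalization.map_units S ⟨m, hm⟩).mul_right_cancel h
  refine ⟨AddMonoidHom.mk' ψ fun s t => ?_, fun a s => ?_, fun x => ?_⟩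
  · obtain ⟨x, m, hm, h⟩ := hden s
    obtain ⟨y, n, hn, h'⟩ := hden t
    refine huniq (m * n) (M.mul_mem hm hn) _ _ ?_
    have hs := hψ s (n ^ p ^ e * x) (m * n) (M.mul_mem hm hn) (by
      simp only [map_mul, map_pow, mul_pow, ← h]; ring)
    have ht := hψ t (m ^ p ^ e * y) (m * n) (M.mul_mem hm hn) (by
      simp only [map_mul, map_pow, mul_pow, ← h']; ring)
    rw [add_mul, hs, ht, ← map_add, ← map_add]
    refine hψ _ _ _ (M.mul_mem hm hn) ?_
    simp only [map_mul, map_pow, mul_pow, map_add, ← h, ← h']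
    ring
  · obtain ⟨x, m, hm, h⟩ := hden s
    obtain ⟨⟨b, n⟩, hb⟩ := IsLocalization.surj M a
    simp only at hb
    refine huniq (m * n) (M.mul_mem hm n.2) _ _ ?_
    have h1 := hψ (a ^ p ^ e * s) (b ^ p ^ e * x) (m * n) (M.mul_mem hm n.2) (by
      simp only [map_mul, map_pow, mul_pow, ← h, ← hb]; ring)
    have h2 := hψ s x m hm h
    rw [AddMonoidHom.mk'_apply, h1, hφ, map_mul, map_mul, ← hb, ← h2]
    ring
  · simpa using hψ (algebraMap R S x) x 1 M.one_mem (by simp)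

theorem localization (M : Submonoid R) [IsLocalization M S] (hp : p.Prime) (hR : (p : R) = 0) (hΦ : IsCartierFamily p e Φ) :
    IsCartierFamily p e {ψ : S →+ S | (∀ a x, ψ (a ^ p ^ e * x) = a * ψ x) ∧
      ∃ φ ∈ Φ, ∀ x, ψ (algebraMap R S x) = algebraMap R S (φ x)} := by
  refine ⟨fun ψ hψ => hψ.1, fun K s hs => ?_⟩
  obtain ⟨x, m, hm, hx⟩ := exists_mul_pow_eq_algebraMap (S := S) (e := e) hp M s
  have h1 : x ∈ frobeniusPow p e (K.comap (algebraMap R S)) := by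
    refine hΦ.mem_of_forall _ _ fun φ hφ => ?_
    obtain ⟨ψ, hψ, hψφ⟩ := exists_extension (S := S) M (hΦ.map_pow_mul φ hφ) hp
    rw [Ideal.mem_comap, ← hψφ, ← hx, mul_comm, hψ]
    exact K.mul_mem_left _ (hs ψ ⟨hψ, φ, hφ, hψφ⟩)
  have h2 := Ideal.mem_map_of_mem (algebraMap R S) h1
  rw [map_frobeniusPow hp hR, ← hx] at h2
  exact frobeniusPow_mono Ideal.map_comap_le <|
    (Ideal.mul_unit_mem_iff_mem _ ((IsLocalization.map_units S (⟨m, hm⟩ : M)).pow _)).mp h2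

theorem frobeniusRoot_map (M : Submonoid R) [IsLocalization M S] (hp : p.Prime) (hR : (p : R) = 0)
    (hΦ : IsCartierFamily p e Φ) (𝔟 : Ideal R) :
    frobeniusRoot p e (𝔟.map (algebraMap R S)) =
      (frobeniusRoot p e 𝔟).map (algebraMap R S) := by
  have hΨ := hΦ.localization (S := S) M hp hR
  apply le_antisymm
  · rw [hΨ.frobeniusRoot_le_iff, ← map_frobeniusPow hp hR]
    exact Ideal.map_mono (hΦ.le_frobeniusPow_frobeniusRoot 𝔟)
  · rw [Ideal.map_le_iff_le_comap, hΦ.frobeniusRoot_eq_span, Ideal.span_le]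
    rintro _ ⟨φ, hφ, x, hx, rfl⟩
    obtain ⟨ψ, hψ, hψφ⟩ := exists_extension (S := S) M (hΦ.map_pow_mul φ hφ) hp
    rw [SetLike.mem_coe, Ideal.mem_comap, ← hψφ]
    exact hΨ.mem_iff.mp (hΨ.le_frobeniusPow_frobeniusRoot _ (Ideal.mem_map_of_mem _ hx)) ψ
      ⟨hψ, φ, hφ, hψφ⟩

end Localization

end IsCartierFamily

/-- On a ring covered by basic open subsets that carry Cartier families, Frobenius roots are
computed locally. -/
theorem frobeniusRoot_eq_iInf_comap {R : Type*} [CommRing R] {p e : ℕ} (hp : p.Prime)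
    (hR : (p : R) = 0) {ι : Type*} [Finite ι] {h : ι → R} (hh : Ideal.span (Set.range h) = ⊤)
    {S : ι → Type*} [∀ i, CommRing (S i)] [∀ i, Algebra R (S i)]
    [∀ i, IsLocalization.Away (h i) (S i)] (hΦ : ∀ i, ∃ Φ, IsCartierFamily (R := S i) p e Φ)
    (𝔟 : Ideal R) :
    frobeniusRoot p e 𝔟 = ⨅ i,
      (frobeniusRoot p e (𝔟.map (algebraMap R (S i)))).comap (algebraMap R (S i)) := by
  have hmem : ∀ i (I : Ideal R) (x : R),
      algebraMap R (S i) x ∈ I.map (algebraMap R (S i)) ↔ ∃ n, h i ^ n * x ∈ I := by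
    intro i I x
    rw [IsLocalization.algebraMap_mem_map_algebraMap_iff (Submonoid.powers (h i))]
    simp [Submonoid.mem_powers_iff]
  have hloc : ∀ (I : Ideal R) (x : R),
      (∀ i, algebraMap R (S i) x ∈ I.map (algebraMap R (S i))) → x ∈ I := by
    intro I x hx
    refine Submodule.mem_of_span_eq_top_of_smul_pow_mem I _ hh x ?_
    rintro ⟨_, i, rfl⟩
    exact (hmem i I x).mp (hx i)
  set K : ι → Ideal R := fun i =>
    (frobeniusRoot p e (𝔟.map (algebraMap R (S i)))).comap (algebraMap R (S i)) with hK
  have hsat : ∀ i (x : R) n, h i ^ n * x ∈ K i → x ∈ K i := by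
    intro i x n hx
    rw [hK, Ideal.mem_comap, map_mul, map_pow] at hx
    exact Ideal.mem_comap.mpr <| (Ideal.unit_mul_mem_iff_mem _
      ((IsLocalization.Away.algebraMap_isUnit (S := S i) (h i)).pow n)).mp hx
  apply le_antisymm
  · refine frobeniusRoot_le fun x hx => hloc _ x fun j => ?_
    obtain ⟨Φ, hΦ'⟩ := hΦ j
    rw [map_frobeniusPow hp hR]
    refine hΦ'.mem_of_forall _ _ fun φ hφ => ?_
    obtain ⟨⟨w, m⟩, hw⟩ := IsLocalization.surj (Submonoid.powers (h j)) (φ (algebraMap R (S j) x))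
    rw [← Ideal.mul_unit_mem_iff_mem _ (IsLocalization.map_units (S j) m), hw]
    -- Some h_i^n x lies in K_i^{[q]}, hence so does (h_i^n)^q x, whose factor leaves φ as h_i^n and
    -- cancels because K_i is saturated with respect to h_i. Finiteness of `ι` then gives a single
    -- power of h_j, which places w in the localized intersection.
    have key : ∀ i, ∃ n, h j ^ n * w ∈ K i := by
      intro i
      obtain ⟨Ψ, hΨ⟩ := hΦ i
      have h1 : algebraMap R (S i) x ∈ (frobeniusPow p e (K i)).map (algebraMap R (S i)) := by
        rw [map_frobeniusPow hp hR, IsLocalization.map_under (Submonoid.powers (h i))]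
        exact hΨ.le_frobeniusPow_frobeniusRoot _ (Ideal.mem_map_of_mem _ hx)
      obtain ⟨n, hn⟩ := (hmem _ _ _).mp h1
      have h2 : (h i ^ n) ^ p ^ e * x ∈ frobeniusPow p e (K i) := by
        rw [← Nat.sub_add_cancel (Nat.one_le_pow e p hp.pos), pow_succ, mul_assoc]
        refine Ideal.mul_mem_left _ _ hn
      have h3 := Ideal.mem_map_of_mem (algebraMap R (S j)) h2
      rw [map_frobeniusPow hp hR, map_mul, map_pow] at h3
      have h4 := hΦ'.mem_iff.mp h3 φ hφ
      rw [hΦ'.map_pow_mul φ hφ] at h4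
      have h5 := Ideal.mul_mem_right (algebraMap R (S j) m) _ h4
      rw [mul_assoc, hw, ← map_mul, hmem] at h5
      obtain ⟨k, hk⟩ := h5
      exact ⟨k, hsat i _ n (by rwa [mul_left_comm])⟩
    choose n hn using key
    classical
    have := Fintype.ofFinite ι
    refine (hmem _ _ _).mpr ⟨∑ i, n i, ?_⟩
    rw [Ideal.mem_iInf]
    intro i
    rw [← Finset.sum_erase_add _ _ (Finset.mem_univ i), pow_add, mul_assoc]
    exact Ideal.mul_mem_left _ _ (hn i)
  · refine le_sInf fun J hJ x hx => hloc J x fun i => ?_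
    refine frobeniusRoot_le ?_ ((Ideal.mem_iInf.mp hx) i)
    rw [← map_frobeniusPow hp hR]
    exact Ideal.map_mono hJ

/-! ### Test ideals of principal ideals in a ring with Cartier families -/

section TestIdeal

variable {R : Type*} [CommRing R] {p : ℕ}

/-- The ideal `(f^{⌈t p^e⌉})^{[1/p^e]}`. -/
noncomputable def approxTestIdeal (p : ℕ) (𝔞 : Ideal R) (t : ℝ) (e : ℕ) : Ideal R :=
  frobeniusRoot p e (𝔞 ^ ⌈t * (p : ℝ) ^ e⌉₊)

/-- The Cartier families exist at all levels, and the ring has characteristic `p`. -/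
structure HasCartierFamilies (R : Type*) [CommRing R] (p : ℕ) : Prop where
  prime : p.Prime
  natCast_eq_zero : (p : R) = 0
  exists_family : ∃ Φ : Set (R →+ R), IsCartierFamily p 1 Φ

namespace HasCartierFamilies

theorem exists_isCartierFamily (h : HasCartierFamilies R p) (e : ℕ) :
    ∃ Φ : Set (R →+ R), IsCartierFamily p e Φ :=
  let ⟨_, hΦ⟩ := h.exists_family
  ⟨_, hΦ.iterate h.prime h.natCast_eq_zero e⟩

theorem frobeniusRoot_add (h : HasCartierFamilies R p) (a b : ℕ) (𝔟 : Ideal R) :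
    frobeniusRoot p (a + b) 𝔟 = frobeniusRoot p b (frobeniusRoot p a 𝔟) := by
  obtain ⟨Φ, hΦ⟩ := h.exists_isCartierFamily (a + b)
  obtain ⟨Φa, hΦa⟩ := h.exists_isCartierFamily a
  obtain ⟨Φb, hΦb⟩ := h.exists_isCartierFamily b
  refine eq_of_forall_ge_iff fun K => ?_
  rw [hΦ.frobeniusRoot_le_iff, hΦb.frobeniusRoot_le_iff, hΦa.frobeniusRoot_le_iff,
    frobeniusPow_add h.prime h.natCast_eq_zero]

/-- From ⌈t p^{e+1}⌉ ≤ p⌈t p^e⌉, the p-th power of f^{⌈t p^e⌉} is a multiple of f^{⌈t p^{e+1}⌉};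
`mem_of_pow_mem` then removes the p-th power. -/
theorem approxTestIdeal_mono (h : HasCartierFamilies R p) (f : R) (t : ℝ) :
    Monotone (approxTestIdeal p (Ideal.span {f}) t) := by
  refine monotone_nat_of_le_succ fun e => ?_
  obtain ⟨Φ, hΦ⟩ := h.exists_isCartierFamily (e + 1)
  obtain ⟨Φ₁, hΦ₁⟩ := h.exists_family
  refine frobeniusRoot_le ?_
  rw [Ideal.span_singleton_pow, Ideal.span_singleton_le_iff_mem]
  refine hΦ₁.mem_of_pow_mem h.prime ?_
  rw [← frobeniusPow_add h.prime h.natCast_eq_zero, add_comm 1 e]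
  refine hΦ.le_frobeniusPow_frobeniusRoot _ ?_
  rw [pow_one, ← pow_mul, Ideal.span_singleton_pow, Ideal.mem_span_singleton]
  refine pow_dvd_pow _ (Nat.ceil_le.mpr ?_)
  rw [pow_succ, ← mul_assoc, Nat.cast_mul]
  exact mul_le_mul_of_nonneg_right (Nat.le_ceil _) (Nat.cast_nonneg _)

variable [IsNoetherianRing R]

theorem eventually_approxTestIdeal_eq (h : HasCartierFamilies R p) (f : R) (t : ℝ) :
    ∀ᶠ e in Filter.atTop,
      approxTestIdeal p (Ideal.span {f}) t e = ringTestIdeal p (Ideal.span {f}) t := by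
  obtain ⟨n, hn⟩ := WellFoundedGT.monotone_chain_condition
    ⟨approxTestIdeal p (Ideal.span {f}) t, h.approxTestIdeal_mono f t⟩
  have : ∀ᶠ e in Filter.atTop, approxTestIdeal p (Ideal.span {f}) t e =
      approxTestIdeal p (Ideal.span {f}) t n :=
    Filter.eventually_atTop.mpr ⟨n, fun e he => (hn e he).symm⟩
  rw [show ringTestIdeal p (Ideal.span {f}) t = _ from ringTestIdeal_eq_of_eventually this]
  exact this

theorem ringTestIdeal_antitone (h : HasCartierFamilies R p) (f : R) :
    Antitone (ringTestIdeal p (Ideal.span {f})) := by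
  intro s t hst
  obtain ⟨e, h1, h2⟩ := ((h.eventually_approxTestIdeal_eq f s).and
    (h.eventually_approxTestIdeal_eq f t)).exists
  rw [← h1, ← h2]
  refine frobeniusRoot_mono (Ideal.pow_le_pow_right (Nat.ceil_mono ?_))
  gcongr

/-- Level e + 1 for the exponent t has the same power of f as level e for p·t, and roots compose. -/
theorem ringTestIdeal_eq_frobeniusRoot (h : HasCartierFamilies R p) (f : R) (t : ℝ) :
    ringTestIdeal p (Ideal.span {f}) t =
      frobeniusRoot p 1 (ringTestIdeal p (Ideal.span {f}) (p * t)) := by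
  obtain ⟨e, h1, h2⟩ := (((Filter.tendsto_add_atTop_nat 1).eventually
    (h.eventually_approxTestIdeal_eq f t)).and
    (h.eventually_approxTestIdeal_eq f (p * t))).exists
  rw [← h1, ← h2, approxTestIdeal, approxTestIdeal, h.frobeniusRoot_add, pow_succ,
    show t * ((p : ℝ) ^ e * p) = p * t * p ^ e by ring]

/-- Raising t by 1 multiplies f^{⌈t p^e⌉} by f^{p^e}, and this factor leaves the root as f. -/
theorem ringTestIdeal_add_one (h : HasCartierFamilies R p) (f : R) {t : ℝ} (ht : 0 ≤ t) :
    ringTestIdeal p (Ideal.span {f}) (t + 1) =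
      Ideal.span {f} * ringTestIdeal p (Ideal.span {f}) t := by
  obtain ⟨e, h1, h2⟩ := ((h.eventually_approxTestIdeal_eq f (t + 1)).and
    (h.eventually_approxTestIdeal_eq f t)).exists
  obtain ⟨Φ, hΦ⟩ := h.exists_isCartierFamily e
  rw [← h1, ← h2, approxTestIdeal, approxTestIdeal, Ideal.span_singleton_pow,
    Ideal.span_singleton_pow, ← hΦ.frobeniusRoot_span_pow_mul, ← pow_add]
  have : (t + 1) * (p : ℝ) ^ e = t * (p : ℝ) ^ e + ((p ^ e : ℕ) : ℝ) := by push_cast; ring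
  rw [this, Nat.ceil_add_natCast (by positivity), add_comm]

end HasCartierFamilies

/-! ### Jumping numbers of a principal ideal -/

/-- `t` is an `F`-jumping number of the principal ideal `(f)` of the ring `R`. -/
def IsRingJump (p : ℕ) (f : R) (t : ℝ) : Prop :=
  0 < t ∧ ∀ μ : ℝ, 0 ≤ μ → μ < t →
    ringTestIdeal p (Ideal.span {f}) t ≠ ringTestIdeal p (Ideal.span {f}) μ

namespace IsRingJump

variable [IsNoetherianRing R] {f : R} {t : ℝ}

theorem prime_mul (h : HasCartierFamilies R p) (ht : IsRingJump p f t) :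
    IsRingJump p f (p * t) := by
  have hp : (0 : ℝ) < p := Nat.cast_pos.mpr h.prime.pos
  refine ⟨mul_pos hp ht.1, fun μ h0 hμ heq => ?_⟩
  refine ht.2 (μ / p) (by positivity) ((div_lt_iff₀' hp).mpr hμ) ?_
  rw [h.ringTestIdeal_eq_frobeniusRoot, heq, h.ringTestIdeal_eq_frobeniusRoot f (μ / p),
    mul_div_cancel₀ _ hp.ne']

theorem prime_pow_mul (h : HasCartierFamilies R p) (ht : IsRingJump p f t) (n : ℕ) :
    IsRingJump p f ((p : ℝ) ^ n * t) := by
  induction n with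
  | zero => simpa using ht
  | succ n ih =>
    rw [pow_succ', mul_assoc]
    exact ih.prime_mul h

theorem sub_one (h : HasCartierFamilies R p) (ht : IsRingJump p f t) (h1 : 1 < t) :
    IsRingJump p f (t - 1) := by
  refine ⟨by linarith, fun μ h0 hμ heq => ht.2 (μ + 1) (by linarith) (by linarith) ?_⟩
  rw [h.ringTestIdeal_add_one f h0, ← heq, ← h.ringTestIdeal_add_one f (by linarith),
    sub_add_cancel]

theorem sub_natCast (h : HasCartierFamilies R p) (ht : IsRingJump p f t) (n : ℕ) (hn : n < t) :
    IsRingJump p f (t - n) := by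
  induction n with
  | zero => simpa using ht
  | succ n ih =>
    push_cast at hn ⊢
    rw [← sub_sub]
    exact (ih (by linarith)).sub_one h (by linarith)

end IsRingJump

/-- If the test ideals of exponent at most `1` are generated by elements of a finite-dimensional
vector space, a strictly decreasing sequence of jumping numbers in `(0, 1]` is shorter than
the dimension plus one. -/
theorem not_strictAnti_isRingJump {k : Type*} [Field k] [Algebra k R] (V : Submodule k R)
    [Module.Finite k V] {f : R} (hp : Antitone (ringTestIdeal p (Ideal.span {f})))
    (hV : ∀ t : ℝ, t ≤ 1 → ∃ s ⊆ (V : Set R), ringTestIdeal p (Ideal.span {f}) t = Ideal.span s)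
    {M : ℕ} (hM : Module.finrank k V < M) (t : ℕ → ℝ) (ht : ∀ i ≤ M, IsRingJump p f (t i))
    (ht1 : ∀ i ≤ M, t i ≤ 1) (hanti : ∀ i < M, t (i + 1) < t i) : False := by
  let W : ℕ → Submodule k V := fun i =>
    ((ringTestIdeal p (Ideal.span {f}) (t i)).restrictScalars k).comap V.subtype
  -- The trace on V determines a test ideal generated by elements of V, so each strict inclusion of
  -- ideals is one of subspaces.
  have hW : ∀ i < M, W i < W (i + 1) := by
    intro i hi
    refine lt_of_le_of_ne (fun x hx => hp (hanti i hi).le hx) fun heq => ?_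
    refine (ht i hi.le).2 (t (i + 1)) (ht (i + 1) hi).1.le (hanti i hi) ?_
    refine le_antisymm (hp (hanti i hi).le) ?_
    obtain ⟨s, hs, hsp⟩ := hV _ (ht1 (i + 1) hi)
    rw [hsp, Ideal.span_le]
    intro x hx
    have h1 : (⟨x, hs hx⟩ : V) ∈ W (i + 1) := by
      change x ∈ ringTestIdeal p (Ideal.span {f}) (t (i + 1))
      rw [hsp]
      exact Ideal.subset_span hx
    rw [← heq] at h1
    exact h1
  have hdim : ∀ i ≤ M, i ≤ Module.finrank k (W i) := by
    intro i
    induction i with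
    | zero => simp
    | succ i ih =>
      intro hi
      exact Nat.succ_le_of_lt ((ih (by omega)).trans_lt (Submodule.finrank_lt_finrank_of_lt (hW i hi)))
  have := (hdim M le_rfl).trans (Submodule.finrank_le (W M))
  omega

/-! ### Periodicity of powers of p and the gap estimate -/

/-- For a prime `p` and `m > 0`, the powers of `p` are eventually periodic modulo `m`. -/
theorem dvd_prime_pow_mul_pow_totient_sub_one {q m : ℕ} (hq : q.Prime) (hm : 0 < m) :
    m ∣ q ^ m * (q ^ m.totient - 1) := by
  obtain ⟨j, m', hm', rfl⟩ := Nat.exists_eq_pow_mul_and_not_dvd hm.ne' q hq.ne_one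
  refine mul_dvd_mul (pow_dvd_pow q ?_) ?_
  · have h1 : j < q ^ j := Nat.lt_pow_self hq.one_lt
    have h2 : 0 < m' := Nat.pos_of_ne_zero (by rintro rfl; simp at hm')
    nlinarith
  · have hco : Nat.Coprime q m' := (Nat.Prime.coprime_iff_not_dvd hq).mpr hm'
    have h1 : m' ∣ q ^ m'.totient - 1 :=
      (Nat.modEq_iff_dvd' (Nat.one_le_pow _ _ hq.pos)).mp (Nat.ModEq.pow_totient hco).symm
    obtain ⟨c, hc⟩ := Nat.totient_dvd_of_dvd (Dvd.intro_left (q ^ j) rfl : m' ∣ q ^ j * m')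
    rw [hc, pow_mul]
    exact h1.trans (by simpa using Nat.sub_dvd_pow_sub_pow (q ^ m'.totient) 1 c)

/-- The gap below `l` for the jumping numbers of a principal ideal, when jumping numbers in
`(0, 1]` do not form strictly decreasing sequences of length `M + 1`. -/
theorem IsRingJump.gap [IsNoetherianRing R] (h : HasCartierFamilies R p) {f : R} {M : ℕ}
    (hM : ∀ t : ℕ → ℝ, (∀ i ≤ M, IsRingJump p f (t i)) → (∀ i ≤ M, t i ≤ 1) →
      (∀ i < M, t (i + 1) < t i) → False)
    {l : ℚ} (hl : 0 < l) {μ : ℝ} (hμ : IsRingJump p f μ) (hμl : μ < l) {N : ℕ}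
    (hN : 2 * l.den + l.den.totient * M ≤ N) :
    1 / (p : ℝ) ^ N ≤ l - μ := by
  by_contra! hlt
  have hp1 : (1 : ℝ) < p := by exact_mod_cast h.prime.one_lt
  have hp0 : (0 : ℝ) < p := by linarith
  set m := l.den with hm_def
  have hm : 0 < m := l.den_pos
  set D := m.totient with hD
  set δ : ℝ := l - μ with hδ
  have hδ0 : 0 < δ := sub_pos.mpr hμl
  obtain ⟨a, ha⟩ : ∃ a : ℕ, (a : ℤ) = l.num := ⟨l.num.toNat, Int.toNat_of_nonneg (Rat.num_pos.mpr hl).le⟩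
  have ha0 : 0 < a := by have := Rat.num_pos.mpr hl; omega
  have hm' : (0 : ℝ) < m := Nat.cast_pos.mpr hm
  have hl' : (l : ℝ) = a / m := by
    rw [Rat.cast_def, ← ha]; simp [hm_def]
  have hpow : 0 < p ^ m * a := Nat.mul_pos (pow_pos h.prime.pos m) ha0
  -- The remainder is taken in 1, …, m instead of 0, …, m - 1, so that b = r/m is positive even when
  -- p^m l is an integer.
  set r := (p ^ m * a - 1) % m + 1 with hr
  set c := (p ^ m * a - 1) / m with hc
  have hrc : p ^ m * a = m * c + r := by
    have := Nat.div_add_mod (p ^ m * a - 1) m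
    rw [← hc] at this
    omega
  have hrm : r ≤ m := Nat.mod_lt _ hm
  obtain ⟨d, hd⟩ : m ∣ (p ^ D - 1) * r := by
    have h1 : m ∣ (p ^ D - 1) * (p ^ m * a) := by
      rw [← mul_assoc, mul_comm (p ^ D - 1)]
      exact (dvd_prime_pow_mul_pow_totient_sub_one h.prime hm).mul_right a
    rw [hrc, mul_add, mul_left_comm] at h1
    exact (Nat.dvd_add_right (Dvd.intro _ rfl)).mp h1
  set b : ℝ := r / m with hb
  have hb0 : 1 / (m : ℝ) ≤ b := by
    rw [hb]
    gcongr
    exact_mod_cast Nat.succ_le_succ (Nat.zero_le _)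
  have hb1 : b ≤ 1 := (div_le_one hm').mpr (by exact_mod_cast hrm)
  have hbc : (p : ℝ) ^ m * l = b + c := by
    have : (p : ℝ) ^ m * a = m * c + r := by exact_mod_cast hrc
    rw [hl', hb]
    field_simp
    linarith
  have hbd : (p : ℝ) ^ D * b = b + d := by
    have h1 : ((p ^ D - 1 : ℕ) : ℝ) * r = m * d := by exact_mod_cast hd
    rw [Nat.cast_sub (Nat.one_le_pow _ _ h.prime.pos)] at h1
    push_cast at h1
    rw [hb]
    field_simp
    linarith
  -- In N, one m pays for the initial factor p^m, D·M for M periods, and the other m for p^{-m} ≤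
  -- 1/m ≤ b, which keeps the sequence positive.
  have hbound : (p : ℝ) ^ (m + D * M) * δ < 1 / m := by
    calc (p : ℝ) ^ (m + D * M) * δ < (p : ℝ) ^ (m + D * M) * (1 / (p : ℝ) ^ N) := by gcongr
      _ ≤ (p : ℝ) ^ (m + D * M) * (1 / (p : ℝ) ^ (m + D * M + m)) := by
        gcongr
        · exact hp1.le
        · omega
      _ = 1 / (p : ℝ) ^ m := by
        rw [pow_add _ (m + D * M) m]
        field_simp
      _ ≤ 1 / m := by
        gcongr
        exact_mod_cast (Nat.lt_pow_self h.prime.one_lt).le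
  have hsmall : ∀ i ≤ M, (p : ℝ) ^ (m + D * i) * δ < b := by
    intro i hi
    refine lt_of_le_of_lt ?_ (hbound.trans_le hb0)
    have : D * i ≤ D * M := Nat.mul_le_mul_left _ hi
    gcongr
    exact hp1.le
  have hjump : ∀ i ≤ M, IsRingJump p f (b - (p : ℝ) ^ (m + D * i) * δ) := by
    intro i
    induction i with
    | zero =>
      intro hi
      have h1 := hsmall 0 hi
      have h2 : (p : ℝ) ^ m * μ - c = b - (p : ℝ) ^ (m + D * 0) * δ := by
        rw [hδ, mul_zero, add_zero, mul_sub, hbc]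
        ring
      rw [← h2]
      exact (hμ.prime_pow_mul h m).sub_natCast h c (by linarith)
    | succ i ih =>
      intro hi
      have h1 := hsmall (i + 1) hi
      have h2 : (p : ℝ) ^ D * (b - (p : ℝ) ^ (m + D * i) * δ) - d =
          b - (p : ℝ) ^ (m + D * (i + 1)) * δ := by
        rw [mul_sub, hbd, ← mul_assoc, ← pow_add, show D + (m + D * i) = m + D * (i + 1) by ring]
        ring
      rw [← h2]
      exact ((ih (by omega)).prime_pow_mul h D).sub_natCast h d (by linarith)
  refine hM (fun i => b - (p : ℝ) ^ (m + D * i) * δ) hjump (fun i _ => ?_) fun i _ => ?_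
  · have : 0 ≤ (p : ℝ) ^ (m + D * i) * δ := by positivity
    linarith
  · have : (p : ℝ) ^ (m + D * i) < (p : ℝ) ^ (m + D * (i + 1)) := by
      refine pow_lt_pow_right₀ hp1 ?_
      have : 0 < D := Nat.totient_pos.mpr hm
      rw [mul_add]
      omega
    exact sub_lt_sub_left (mul_lt_mul_of_pos_right this hδ0) b

end TestIdeal

/-! ### The Cartier family of a polynomial ring over a field -/

/-- Coordinates of a field of characteristic `p` over itself through Frobenius. -/
theorem exists_frobenius_coordinates (k : Type u) [Field k] (p : ℕ) [hp : Fact p.Prime] [CharP k p] :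
    ∃ (ι : Type u) (b : ι → k) (c : ι → k →+ k), (∀ j a x, c j (a ^ p * x) = a * c j x) ∧
      ∀ x, ∃ s : Finset ι, ∀ t, s ⊆ t → ∑ j ∈ t, c j x ^ p * b j = x := by
  -- The coordinates are p-th roots of coordinates over the subfield k^p. The basis may be infinite,
  -- hence the finite set depending on x.
  let F : Subfield k := (frobenius k p).fieldRange
  let B := Module.Basis.ofVectorSpace F k
  have hF : ∀ y : F, ∃ z : k, z ^ p = (y : k) := fun y => y.2
  choose g hg using hF
  have hinj : ∀ x y : k, x ^ p = y ^ p → x = y := fun x y h => frobenius_inj k p h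
  refine ⟨_, B, fun j => AddMonoidHom.mk' (fun x => g (B.repr x j)) fun x y => ?_, fun j a x => ?_,
    fun x => ⟨(B.repr x).support, fun t ht => ?_⟩⟩
  · apply hinj
    rw [hg, add_pow_char, hg, hg]
    simp
  · apply hinj
    have : a ^ p * x = (⟨a ^ p, a, rfl⟩ : F) • x := rfl
    simp only [AddMonoidHom.mk'_apply]
    rw [mul_pow, hg, hg, this]
    simp
  · simp only [AddMonoidHom.mk'_apply, hg]
    conv_rhs => rw [← B.linearCombination_repr x]
    rw [Finsupp.linearCombination_apply, Finsupp.sum]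
    refine (Finset.sum_subset ht fun j _ hj => ?_).symm
    rw [Finsupp.notMem_support_iff.mp hj, ZeroMemClass.coe_zero, zero_mul]

namespace MvPolynomial

variable {σ : Type*} {k : Type u} [Field k] {p : ℕ}

open Classical in
/-- The `p^{-1}`-linear endomorphism of a polynomial ring that sends `a X^m` to
`c(a) X^{(m - α)/p}`, and to zero when `m` is not congruent to `α` modulo `p`. -/
noncomputable def cartierMap (p : ℕ) (c : k →+ k) (α : σ →₀ ℕ) :
    MvPolynomial σ k →+ MvPolynomial σ k :=
  (Finsupp.liftAddHom fun m : σ →₀ ℕ =>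
    if m.mapRange (· % p) (Nat.zero_mod p) = α then
      (monomial (m.mapRange (· / p) (Nat.zero_div p))).toAddMonoidHom.comp c
    else 0).comp AddMonoidAlgebra.coeffAddEquiv.toAddMonoidHom

open Classical in
theorem cartierMap_monomial (c : k →+ k) (α m : σ →₀ ℕ) (a : k) :
    cartierMap p c α (monomial m a) = if m.mapRange (· % p) (Nat.zero_mod p) = α then
      monomial (m.mapRange (· / p) (Nat.zero_div p)) (c a) else 0 := by
  have : AddMonoidAlgebra.coeffAddEquiv (monomial m a) = Finsupp.single m a := rfl
  simp only [cartierMap, AddMonoidHom.comp_apply, AddEquiv.toAddMonoidHom_eq_coe,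
    AddMonoidHom.coe_coe, this, Finsupp.liftAddHom_apply_single]
  split_ifs <;> rfl

theorem cartierMap_pow_mul (hp : p.Prime) (hk : (p : k) = 0) {c : k →+ k}
    (hc : ∀ a x, c (a ^ p * x) = a * c x) (α : σ →₀ ℕ) (f h : MvPolynomial σ k) :
    cartierMap p c α (f ^ p * h) = f * cartierMap p c α h := by
  classical
  have hP : (p : MvPolynomial σ k) = 0 := by rw [← map_natCast (C : k →+* MvPolynomial σ k), hk, map_zero]
  induction f using MvPolynomial.induction_on' with
  | add f f' hf hf' =>
    have h1 := add_pow_prime_pow_of_natCast_eq_zero hp hP 1 f f'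
    rw [pow_one] at h1
    rw [h1, add_mul, map_add, hf, hf', add_mul]
  | monomial m a =>
    induction h using MvPolynomial.induction_on' with
    | add h h' hh hh' => rw [mul_add, map_add, hh, hh', map_add, mul_add]
    | monomial n b =>
      have h1 : (p • m + n).mapRange (· % p) (Nat.zero_mod p) =
          n.mapRange (· % p) (Nat.zero_mod p) := by
        ext i; simp
      have h2 : (p • m + n).mapRange (· / p) (Nat.zero_div p) =
          m + n.mapRange (· / p) (Nat.zero_div p) := by
        ext i; simp [Nat.mul_add_div hp.pos]
      rw [monomial_pow, monomial_mul, cartierMap_monomial, cartierMap_monomial, h1, h2, hc]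
      split_ifs
      · rw [monomial_mul]
      · rw [mul_zero]

/-- Exponents are divided by p and rounded down, so p times the new degree is at most the old one.
-/
theorem totalDegree_cartierMap_le (c : k →+ k) (α : σ →₀ ℕ) {h : MvPolynomial σ k}
    {n : ℕ} (hn : h.totalDegree < p * (n + 1)) : (cartierMap p c α h).totalDegree ≤ n := by
  classical
  rw [← mem_restrictTotalDegree, h.as_sum, map_sum]
  refine Submodule.sum_mem _ fun m hm => ?_
  rw [cartierMap_monomial]
  split_ifs
  · rw [mem_restrictTotalDegree]
    refine (totalDegree_monomial_le _ _).trans ?_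
    have h1 : (m.sum fun _ e => e) < p * (n + 1) := (le_totalDegree hm).trans_lt hn
    have h2 : p * ((m.mapRange (· / p) (Nat.zero_div p)).sum fun _ e => e) ≤ m.sum fun _ e => e := by
      rw [Finsupp.sum_mapRange_index (by simp), Finsupp.sum, Finsupp.sum, Finset.mul_sum]
      exact Finset.sum_le_sum fun i _ => Nat.mul_div_le _ _
    exact Nat.lt_succ_iff.mp (Nat.lt_of_mul_lt_mul_left (h2.trans_lt h1))
  · exact zero_mem _

/-- Every x equals ∑ φ_{j,α}(x)^p b_j X^α, with b_j a basis of k over k^p and α running over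
exponents reduced modulo p; this expansion gives detection. -/
theorem exists_isCartierFamily (hp : p.Prime) (hk : (p : k) = 0) :
    ∃ Φ : Set (MvPolynomial σ k →+ MvPolynomial σ k), IsCartierFamily p 1 Φ ∧
      ∀ φ ∈ Φ, ∀ (h : MvPolynomial σ k) (n : ℕ), h.totalDegree < p * (n + 1) →
        (φ h).totalDegree ≤ n := by
  classical
  have : Fact p.Prime := ⟨hp⟩
  have : CharP k p := (CharP.charP_iff_prime_eq_zero hp).mpr hk
  obtain ⟨ι, b, c, hc, hb⟩ := exists_frobenius_coordinates k p
  refine ⟨{φ | ∃ j α, φ = cartierMap p (c j) α}, ⟨?_, fun K x hx => ?_⟩, ?_⟩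
  · rintro _ ⟨j, α, rfl⟩ a x
    rw [pow_one, cartierMap_pow_mul hp hk (hc j)]
  · choose s hs using hb
    let T : Finset ι := x.support.biUnion fun m => s (x.coeff m)
    let A : Finset (σ →₀ ℕ) := x.support.image fun m => m.mapRange (· % p) (Nat.zero_mod p)
    have key : ∀ m ∈ x.support, monomial m (x.coeff m) = ∑ j ∈ T, ∑ α ∈ A,
        cartierMap p (c j) α (monomial m (x.coeff m)) ^ p * monomial α (b j) := by
      intro m hm
      conv_lhs => rw [← hs (x.coeff m) T (Finset.subset_biUnion_of_mem (fun m => s (x.coeff m)) hm),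
        map_sum]
      refine Finset.sum_congr rfl fun j _ => ?_
      rw [Finset.sum_eq_single_of_mem (m.mapRange (· % p) (Nat.zero_mod p))
        (Finset.mem_image_of_mem _ hm)]
      · rw [cartierMap_monomial, if_pos rfl, monomial_pow, monomial_mul]
        have : p • m.mapRange (· / p) (Nat.zero_div p) + m.mapRange (· % p) (Nat.zero_mod p) = m := by
          ext i
          simp [Nat.div_add_mod]
        rw [this]
      · intro α _ hα
        rw [cartierMap_monomial, if_neg hα.symm, zero_pow hp.ne_zero, zero_mul]
    have hx' : x = ∑ j ∈ T, ∑ α ∈ A, cartierMap p (c j) α x ^ p * monomial α (b j) := by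
      conv_lhs => rw [x.as_sum, Finset.sum_congr rfl key, Finset.sum_comm]
      refine Finset.sum_congr rfl fun j _ => ?_
      rw [Finset.sum_comm]
      refine Finset.sum_congr rfl fun α _ => ?_
      rw [← Finset.sum_mul, ← sum_pow_char, ← map_sum, ← x.as_sum]
    rw [hx']
    refine Ideal.sum_mem _ fun j _ => Ideal.sum_mem _ fun α _ => Ideal.mul_mem_right _ _ ?_
    have := pow_mem_frobeniusPow (p := p) (e := 1) (hx _ ⟨j, α, rfl⟩)
    rwa [pow_one] at this
  · rintro _ ⟨j, α, rfl⟩ h n hn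
    exact totalDegree_cartierMap_le _ _ hn

/-- The number of monomials of degree at most `d`. -/
noncomputable def numMonomials (σ : Type*) (d : ℕ) : ℕ :=
  Nat.card {n : σ →₀ ℕ | (n.sum fun _ e => e) ≤ d}

theorem finrank_restrictTotalDegree (d : ℕ) :
    Module.finrank k (restrictTotalDegree σ k d) = numMonomials σ d :=
  Module.finrank_eq_nat_card_basis (basisRestrictSupport k _)

end MvPolynomial

/-! ### Complete intersections with invertible Jacobian -/

section Jacobian

variable {k P : Type*} [CommRing k] [CommRing P] [Algebra k P]

/-- Since D(g^{n+1} y) = g^n((n+1)·Dg·y + g·Dy), each application of D trades one factor g for Dg,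
modulo g. -/
theorem Derivation.factorial_mul_mem {D : Derivation k P P} {L : Ideal P} {g : P}
    (hD : ∀ x ∈ L, D x ∈ L) (n : ℕ) {y : P} (hy : g ^ n * y ∈ L) :
    (n.factorial : P) * D g ^ n * y ∈ L ⊔ Ideal.span {g} := by
  induction n generalizing y with
  | zero => simpa using Ideal.mem_sup_left hy
  | succ n ih =>
    have h1 : g ^ n * ((n + 1) * D g * y + g * D y) ∈ L := by
      convert hD _ hy using 1
      simp only [Derivation.leibniz, Derivation.leibniz_pow, smul_eq_mul, nsmul_eq_mul]
      rw [Nat.add_sub_cancel]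
      push_cast
      ring
    have h2 := ih h1
    have h3 : (n.factorial : P) * D g ^ n * (g * D y) ∈ L ⊔ Ideal.span {g} :=
      Ideal.mem_sup_right (Ideal.mem_span_singleton.mpr ⟨n.factorial * D g ^ n * D y, by ring⟩)
    convert sub_mem h2 h3 using 1
    rw [Nat.factorial_succ]
    push_cast
    ring

theorem isUnit_factorial_of_natCast_eq_zero {R : Type*} [CommRing R] {p n : ℕ} (hp : p.Prime)
    (hR : (p : R) = 0) (hn : n < p) : IsUnit (n.factorial : R) := by
  have hco : Nat.Coprime n.factorial p :=
    ((Nat.Prime.coprime_iff_not_dvd hp).mpr fun h => by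
      rw [hp.dvd_factorial] at h; omega).symm
  have := congrArg (Int.cast : ℤ → R) (Nat.gcd_eq_gcd_ab n.factorial p)
  rw [Nat.Coprime.gcd_eq_one hco] at this
  push_cast at this
  rw [hR, zero_mul, add_zero] at this
  exact IsUnit.of_mul_eq_one _ this.symm

/-- Derivations annihilate p-th powers. -/
theorem Derivation.map_mem_frobeniusPow {p : ℕ} (hR : (p : P) = 0) (D : Derivation k P P)
    (K : Ideal P) {x : P} (hx : x ∈ frobeniusPow p 1 K) : D x ∈ frobeniusPow p 1 K := by
  refine Submodule.span_induction (p := fun x _ => D x ∈ frobeniusPow p 1 K) ?_ ?_ ?_ ?_ hx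
  · rintro _ ⟨h, hh, rfl⟩
    simp [Derivation.leibniz_pow, hR]
  · simp
  · intro x y _ _ hx hy
    rw [map_add]
    exact add_mem hx hy
  · intro a x hx' hx
    rw [smul_eq_mul, Derivation.leibniz, smul_eq_mul, smul_eq_mul]
    exact add_mem (Ideal.mul_mem_left _ _ hx) (Ideal.mul_mem_right _ _ hx')

theorem Derivation.map_mem_span {D : Derivation k P P} {s : Set P} (hs : ∀ g ∈ s, D g = 0)
    {x : P} (hx : x ∈ Ideal.span s) : D x ∈ Ideal.span s := by
  refine Submodule.span_induction (p := fun x _ => D x ∈ Ideal.span s) ?_ ?_ ?_ ?_ hx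
  · intro g hg
    simp [hs g hg]
  · simp
  · intro x y _ _ hx hy
    rw [map_add]
    exact add_mem hx hy
  · intro a x hx' hx
    rw [smul_eq_mul, Derivation.leibniz, smul_eq_mul, smul_eq_mul]
    exact add_mem (Ideal.mul_mem_left _ _ hx) (Ideal.mul_mem_right _ _ hx')

variable {ι : Type*} [Fintype ι] [DecidableEq ι] {p : ℕ}

/-- A Fedder-type criterion: up to a power of the Jacobian determinant, multiplication by
`∏ g_i^{p-1}` detects `K^{[p]} + (g_i)`. -/
theorem exists_pow_mul_mem_of_mul_prod_mem (hp : p.Prime) (hP : (p : P) = 0) {g : ι → P} {Δ : P}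
    {D : ι → Derivation k P P} (hD : ∀ i j, D i (g j) = if i = j then Δ else 0) (K : Ideal P)
    {f : P} (hf : f * ∏ i, g i ^ (p - 1) ∈ frobeniusPow p 1 K) :
    ∃ n : ℕ, Δ ^ n * f ∈ frobeniusPow p 1 K ⊔ Ideal.span (Set.range g) := by
  -- The factors g_j^{p-1} are removed one at a time: D_j preserves K^{[p]} and kills the other g_i,
  -- so p - 1 derivations replace g_j^{p-1} by (p-1)!·Δ^{p-1} modulo g_j, and (p-1)! is a unit.
  have key : ∀ (s : Finset ι) (f : P),
      f * ∏ i ∈ s, g i ^ (p - 1) ∈ frobeniusPow p 1 K ⊔ Ideal.span (g '' {i | i ∉ s}) →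
      ∃ n : ℕ, Δ ^ n * f ∈ frobeniusPow p 1 K ⊔ Ideal.span (Set.range g) := by
    intro s
    induction s using Finset.induction_on with
    | empty =>
      intro f hf
      refine ⟨0, ?_⟩
      simpa using hf
    | insert j s hj ih =>
      intro f hf
      rw [Finset.prod_insert hj] at hf
      set L := frobeniusPow p 1 K ⊔ Ideal.span (g '' {i | i ∉ insert j s}) with hL
      have hLD : ∀ x ∈ L, D j x ∈ L := by
        intro x hx
        obtain ⟨y, hy, z, hz, rfl⟩ := Submodule.mem_sup.mp hx
        rw [map_add]
        refine add_mem (Ideal.mem_sup_left ((D j).map_mem_frobeniusPow hP K hy))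
          (Ideal.mem_sup_right (Derivation.map_mem_span ?_ hz))
        rintro _ ⟨i, hi, rfl⟩
        rw [hD, if_neg]
        rintro rfl
        simp at hi
      have h1 := Derivation.factorial_mul_mem hLD (p - 1) (y := f * ∏ i ∈ s, g i ^ (p - 1))
        (by rwa [mul_left_comm] at hf)
      rw [hD, if_pos rfl, mul_assoc, Ideal.unit_mul_mem_iff_mem _
        (isUnit_factorial_of_natCast_eq_zero hp hP (Nat.sub_lt hp.pos one_pos))] at h1
      have h2 : L ⊔ Ideal.span {g j} ≤ frobeniusPow p 1 K ⊔ Ideal.span (g '' {i | i ∉ s}) := by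
        rw [hL, sup_assoc, ← Ideal.span_union]
        refine sup_le_sup_left (Ideal.span_mono (Set.union_subset ?_ ?_)) _
        · exact Set.image_mono fun i hi his => hi (Finset.mem_insert_of_mem his)
        · exact Set.singleton_subset_iff.mpr ⟨j, hj, rfl⟩
      obtain ⟨n, hn⟩ := ih (Δ ^ (p - 1) * f) (by rw [mul_assoc]; exact h2 h1)
      exact ⟨n + (p - 1), by rwa [pow_add, mul_assoc]⟩
  exact key Finset.univ f (Ideal.mem_sup_left hf)

/-- A Cartier family descends to a quotient `P/I` after multiplication by an element `u` with
`u I ⊆ I^{[p]}` that detects `K^{[p]} + I`. -/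
theorem IsCartierFamily.quotient {R : Type*} [CommRing R] (hp : p.Prime) (hP : (p : P) = 0)
    {Φ : Set (P →+ P)} (hΦ : IsCartierFamily p 1 Φ) {π : P →+* R} (hπ : Function.Surjective π)
    {u : P} (hu : ∀ x ∈ RingHom.ker π, u * x ∈ frobeniusPow p 1 (RingHom.ker π))
    (hdet : ∀ K : Ideal P, RingHom.ker π ≤ K → ∀ x, u * x ∈ frobeniusPow p 1 K →
      x ∈ frobeniusPow p 1 K ⊔ RingHom.ker π) :
    IsCartierFamily p 1 {ψ : R →+ R | (∀ a x, ψ (a ^ p ^ 1 * x) = a * ψ x) ∧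
      ∃ φ ∈ Φ, ∀ x, ψ (π x) = π (φ (u * x))} := by
  refine ⟨fun ψ hψ => hψ.1, fun K y hy => ?_⟩
  obtain ⟨x, rfl⟩ := hπ y
  have hK : RingHom.ker π ≤ K.comap π := Ideal.comap_mono (f := π) bot_le
  have h1 : u * x ∈ frobeniusPow p 1 (K.comap π) := by
    refine hΦ.mem_of_forall _ _ fun φ hφ => ?_
    -- Because u·I ⊆ I^{[p]} for I = ker π, the map x ↦ π(φ(u x)) vanishes on I and descends to R.
    let θ : P →+ R := π.toAddMonoidHom.comp (φ.comp (AddMonoidHom.mulLeft u))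
    have hθ : π.toAddMonoidHom.ker ≤ θ.ker := fun z hz => hΦ.mem_iff.mp (hu z hz) φ hφ
    let ψ : R →+ R := π.toAddMonoidHom.liftOfRightInverse (Function.surjInv hπ)
      (Function.rightInverse_surjInv hπ) ⟨θ, hθ⟩
    have hψ : ∀ z, ψ (π z) = π (φ (u * z)) := fun z =>
      AddMonoidHom.liftOfRightInverse_comp_apply _ _ (Function.rightInverse_surjInv hπ) ⟨θ, hθ⟩ z
    have := hy ψ ⟨fun a z => ?_, φ, hφ, hψ⟩
    · rwa [hψ] at this
    · obtain ⟨a, rfl⟩ := hπ a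
      obtain ⟨z, rfl⟩ := hπ z
      rw [← map_pow, ← map_mul, hψ, hψ, mul_left_comm, hΦ.map_pow_mul φ hφ, map_mul]
  clear hy
  obtain ⟨y, hy, z, hz, rfl⟩ := Submodule.mem_sup.mp (hdet _ hK x h1)
  rw [map_add, RingHom.mem_ker.mp hz, add_zero]
  have h2 := Ideal.mem_map_of_mem π hy
  rw [map_frobeniusPow hp hP] at h2
  exact frobeniusPow_mono Ideal.map_comap_le h2

end Jacobian

/-! ### Degree bounds and gaps on standard smooth algebras over a field -/

section SmoothAlgebra

open MvPolynomial

variable {k : Type u} [Field k] {p : ℕ} {σ ι : Type*} [Fintype ι] [DecidableEq ι]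
  {R : Type*} [CommRing R] [Algebra k R] {g : ι → MvPolynomial σ k} {a : ι → σ}
  {π : MvPolynomial σ k →ₐ[k] R}

/-- A standard smooth algebra over a field of characteristic `p` has a Cartier family whose
members contract degrees. -/
theorem exists_isCartierFamily_of_jacobian (hp : p.Prime) (hk : (p : k) = 0)
    (hπ : Function.Surjective π) (hker : RingHom.ker π = Ideal.span (Set.range g))
    (hjac : IsUnit (π (Matrix.of fun i j => pderiv (a i) (g j)).det)) :
    ∃ Φ : Set (R →+ R), IsCartierFamily p 1 Φ ∧
      ∀ ψ ∈ Φ, ∀ (h : MvPolynomial σ k) (n : ℕ),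
        h.totalDegree ≤ p * n + ∑ i, (g i).totalDegree →
        ∃ h' : MvPolynomial σ k, h'.totalDegree ≤ n + ∑ i, (g i).totalDegree ∧ ψ (π h) = π h' := by
  have hP : (p : MvPolynomial σ k) = 0 := by
    rw [← map_natCast (C : k →+* MvPolynomial σ k), hk, map_zero]
  obtain ⟨Φ, hΦ, hdeg⟩ := MvPolynomial.exists_isCartierFamily (σ := σ) hp hk
  set G := ∏ i, g i ^ (p - 1) with hG
  set J : Matrix ι ι (MvPolynomial σ k) := Matrix.of fun i j => pderiv (a i) (g j) with hJ
  have hdet : ∀ K : Ideal (MvPolynomial σ k), RingHom.ker (π : MvPolynomial σ k →+* R) ≤ K →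
      ∀ x, G * x ∈ frobeniusPow p 1 K →
        x ∈ frobeniusPow p 1 K ⊔ RingHom.ker (π : MvPolynomial σ k →+* R) := by
    intro K hK x hx
    -- The rows of the adjugate combine the partial derivatives into derivations dual to the g_j, up
    -- to the factor det J.
    have hD : ∀ i j, (∑ l, J.adjugate i l • pderiv (R := k) (a l)) (g j) =
        if i = j then J.det else 0 := by
      intro i j
      have := congrFun (congrFun J.adjugate_mul i) j
      rw [Matrix.mul_apply] at this
      simp only [hJ, Matrix.of_apply, Matrix.smul_apply, Matrix.one_apply, smul_eq_mul, mul_ite,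
        mul_one, mul_zero] at this
      rw [← this]
      rw [← Derivation.coeFnAddMonoidHom_apply, map_sum, Finset.sum_apply]
      rfl
    obtain ⟨n, hn⟩ := exists_pow_mul_mem_of_mul_prod_mem hp hP
      (D := fun i => ∑ l, J.adjugate i l • pderiv (R := k) (a l)) hD K
      (by rwa [mul_comm] at hx)
    have hker' : RingHom.ker (π : MvPolynomial σ k →+* R) = Ideal.span (Set.range g) := hker
    rw [← hker'] at hn
    obtain ⟨v, hv⟩ := hπ (hjac.unit⁻¹ ^ n : Rˣ)
    -- The determinant is invertible modulo the kernel, so its power can be cancelled.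
    have h1 : 1 - v * J.det ^ n ∈ RingHom.ker (π : MvPolynomial σ k →+* R) := by
      rw [RingHom.mem_ker]
      simp [hv, ← mul_pow]
    have h2 := add_mem (Ideal.mul_mem_left _ v hn)
      (Ideal.mem_sup_right (S := frobeniusPow p 1 K) (Ideal.mul_mem_right x _ h1))
    convert h2 using 1
    ring
  refine ⟨_, IsCartierFamily.quotient hp hP hΦ hπ (u := G) ?_ hdet, ?_⟩
  · change ∀ x ∈ RingHom.ker (π : MvPolynomial σ k →+* R),
      G * x ∈ frobeniusPow p 1 (RingHom.ker (π : MvPolynomial σ k →+* R))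
    intro x hx
    have hker' : RingHom.ker (π : MvPolynomial σ k →+* R) = Ideal.span (Set.range g) := hker
    rw [hker'] at hx ⊢
    refine Submodule.span_induction
      (p := fun x _ => G * x ∈ frobeniusPow p 1 (Ideal.span (Set.range g))) ?_ ?_ ?_ ?_ hx
    · rintro _ ⟨i, rfl⟩
      have h1 := pow_mem_frobeniusPow (p := p) (e := 1) (J := Ideal.span (Set.range g))
        (Ideal.subset_span ⟨i, rfl⟩ : g i ∈ Ideal.span (Set.range g))
      rw [pow_one, show g i ^ p = g i ^ (p - 1) * g i by
        rw [← pow_succ, Nat.sub_add_cancel hp.one_le]] at h1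
      rw [hG, ← Finset.mul_prod_erase _ _ (Finset.mem_univ i), mul_right_comm]
      exact Ideal.mul_mem_right _ _ h1
    · simp
    · intro x y _ _ hx hy
      rw [mul_add]
      exact add_mem hx hy
    · intro b x _ hx
      rw [smul_eq_mul, mul_left_comm]
      exact Ideal.mul_mem_left _ _ hx
  · rintro ψ ⟨-, φ, hφ, hψ⟩ h n hn
    refine ⟨φ (G * h), hdeg φ hφ _ _ ?_, hψ h⟩
    -- With E = ∑ deg g_i, deg(G·h) ≤ (p-1)E + pn + E = p(n + E). The excess E is therefore
    -- reproduced exactly and does not grow under iteration.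
    have h1 : G.totalDegree ≤ (p - 1) * ∑ i, (g i).totalDegree := by
      refine (totalDegree_finsetProd _ _).trans ?_
      rw [Finset.mul_sum]
      exact Finset.sum_le_sum fun i _ => totalDegree_pow _ _
    have h2 := totalDegree_mul G h
    obtain ⟨q, rfl⟩ : ∃ q, p = q + 1 := ⟨p - 1, (Nat.sub_add_cancel hp.one_le).symm⟩
    rw [Nat.add_sub_cancel] at h1
    nlinarith

/-- The gap below `l` for jumping numbers on a standard smooth algebra, with a bound that depends
only on `l`, on the degrees of the equations and on the number of variables. -/
theorem IsRingJump.gap_of_jacobian [Finite σ] (hp : p.Prime) (hk : (p : k) = 0)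
    (hπ : Function.Surjective π) (hker : RingHom.ker π = Ideal.span (Set.range g))
    (hjac : IsUnit (π (Matrix.of fun i j => pderiv (a i) (g j)).det)) {f : MvPolynomial σ k} {d : ℕ}
    (hd : f.totalDegree + ∑ i, (g i).totalDegree ≤ d)
    {l : ℚ} (hl : 0 < l) {μ : ℝ} (hμ : IsRingJump p (π f) μ) (hμl : μ < l) {N : ℕ}
    (hN : 2 * l.den + l.den.totient * (numMonomials σ d + 1) ≤ N) :
    1 / (p : ℝ) ^ N ≤ l - μ := by
  obtain ⟨Φ, hΦ, hdeg⟩ := exists_isCartierFamily_of_jacobian hp hk hπ hker hjac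
  have hR : (p : R) = 0 := by rw [← map_natCast (algebraMap k R), hk, map_zero]
  have hfam : HasCartierFamilies R p := ⟨hp, hR, Φ, hΦ⟩
  have : IsNoetherianRing R := isNoetherianRing_of_surjective _ _ π.toRingHom hπ
  have hiter : ∀ (e n : ℕ), ∀ χ ∈ iterateFamily Φ e, ∀ h : MvPolynomial σ k,
      h.totalDegree ≤ p ^ e * n + ∑ i, (g i).totalDegree →
      ∃ h' : MvPolynomial σ k, h'.totalDegree ≤ n + ∑ i, (g i).totalDegree ∧ χ (π h) = π h' := by
    intro e n
    induction e with
    | zero =>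
      rintro _ rfl h hh
      exact ⟨h, by simpa using hh, rfl⟩
    | succ e ih =>
      rintro _ ⟨φ, hφ, ψ, hψ, rfl⟩ h hh
      obtain ⟨h', hh', heq⟩ := hdeg φ hφ h (p ^ e * n) (by rwa [← mul_assoc, ← pow_succ'])
      obtain ⟨h'', hh'', heq'⟩ := ih ψ hψ h' hh'
      exact ⟨h'', hh'', by rw [AddMonoidHom.comp_apply, heq, heq']⟩
  refine hμ.gap hfam (M := numMonomials σ d + 1) (fun t ht ht1 hanti => ?_) hl hμl hN
  let V : Submodule k R := (restrictTotalDegree σ k d).map π.toLinearMap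
  refine not_strictAnti_isRingJump V (hfam.ringTestIdeal_antitone _) (fun t ht => ?_) ?_ t ht ht1
    hanti
  · obtain ⟨e, he⟩ := (hfam.eventually_approxTestIdeal_eq (π f) t).exists
    rw [← he, approxTestIdeal, Ideal.span_singleton_pow,
      (hΦ.iterate hp hR e).frobeniusRoot_span_singleton]
    refine ⟨_, ?_, rfl⟩
    rintro _ ⟨χ, hχ, rfl⟩
    -- This is where t ≤ 1 enters: the power of f has degree at most p^e·deg f, which e contractions
    -- bring down to deg f, plus the excess.
    have h1 : ⌈t * (p : ℝ) ^ e⌉₊ ≤ p ^ e := by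
      refine Nat.ceil_le.mpr ?_
      push_cast
      exact mul_le_of_le_one_left (by positivity) ht
    obtain ⟨h', hh', heq⟩ := hiter e f.totalDegree χ hχ (f ^ ⌈t * (p : ℝ) ^ e⌉₊)
      ((totalDegree_pow _ _).trans (le_add_right (Nat.mul_le_mul_right _ h1)))
    rw [← map_pow, heq]
    exact ⟨h', (mem_restrictTotalDegree _ _ _).mpr (hh'.trans hd), rfl⟩
  · refine Nat.lt_succ_of_le ((Submodule.finrank_map_le _ _).trans ?_)
    rw [finrank_restrictTotalDegree]

end SmoothAlgebra

/-! ### Comparing test ideals locally -/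

/-- If `Spec R` is covered by basic open subsets that are also basic open subsets of spectra of
rings with Cartier families, then two test ideals on `R` agree as soon as they agree on these. -/
theorem ringTestIdeal_eq_of_cover {R : Type*} [CommRing R] {p : ℕ} (hp : p.Prime)
    (hR : (p : R) = 0) {ι : Type*} [Finite ι] {h : ι → R} (hh : Ideal.span (Set.range h) = ⊤)
    {S : ι → Type*} [∀ i, CommRing (S i)] [∀ i, Algebra R (S i)]
    [∀ i, IsLocalization.Away (h i) (S i)]
    {T : ι → Type*} [∀ i, CommRing (T i)] [∀ i, IsNoetherianRing (T i)] [∀ i, Algebra (T i) (S i)]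
    {g : ∀ i, T i} [∀ i, IsLocalization.Away (g i) (S i)] (hT : ∀ i, HasCartierFamilies (T i) p)
    {𝔞 : Ideal R} {f : ∀ i, T i}
    (h𝔞 : ∀ i, 𝔞.map (algebraMap R (S i)) = (Ideal.span {f i}).map (algebraMap (T i) (S i)))
    {s t : ℝ}
    (hst : ∀ i, ringTestIdeal p (Ideal.span {f i}) s = ringTestIdeal p (Ideal.span {f i}) t) :
    ringTestIdeal p 𝔞 s = ringTestIdeal p 𝔞 t := by
  have hΦ : ∀ e i, ∃ Φ, IsCartierFamily (R := S i) p e Φ := fun e i =>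
    let ⟨_, hΦ⟩ := (hT i).exists_isCartierFamily e
    ⟨_, hΦ.localization (Submonoid.powers (g i)) hp (hT i).natCast_eq_zero⟩
  have hroot : ∀ (r : ℝ) (e : ℕ), frobeniusRoot p e (𝔞 ^ ⌈r * (p : ℝ) ^ e⌉₊) =
      ⨅ i, ((approxTestIdeal p (Ideal.span {f i}) r e).map (algebraMap (T i) (S i))).comap
        (algebraMap R (S i)) := by
    intro r e
    rw [frobeniusRoot_eq_iInf_comap hp hR hh (hΦ e)]
    refine iInf_congr fun i => ?_
    obtain ⟨Ψ, hΨ⟩ := (hT i).exists_isCartierFamily e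
    rw [Ideal.map_pow, h𝔞, ← Ideal.map_pow,
      hΨ.frobeniusRoot_map (Submonoid.powers (g i)) hp (hT i).natCast_eq_zero]
    rfl
  refine Filter.liminf_congr ?_
  have : ∀ i, ∀ᶠ e in Filter.atTop, approxTestIdeal p (Ideal.span {f i}) s e =
      approxTestIdeal p (Ideal.span {f i}) t e := fun i => by
    filter_upwards [(hT i).eventually_approxTestIdeal_eq (f i) s,
      (hT i).eventually_approxTestIdeal_eq (f i) t] with e h1 h2
    rw [h1, h2, hst i]
  filter_upwards [Filter.eventually_all.mpr this] with e he
  rw [hroot, hroot]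
  exact iInf_congr fun i => by rw [he i]

/-! ### Uniform gaps in the fibers of a standard smooth algebra -/

theorem MvPolynomial.totalDegree_map_le {σ A B : Type*} [CommSemiring A] [CommSemiring B]
    (φ : A →+* B) (f : MvPolynomial σ A) : (MvPolynomial.map φ f).totalDegree ≤ f.totalDegree :=
  Finset.sup_mono (MvPolynomial.support_map_subset _ _)

open scoped TensorProduct in
attribute [local instance] Fintype.ofFinite in
/-- On the fibers of a standard smooth algebra, there are Cartier families, and the gap below `l`
for the jumping numbers of a principal ideal is uniform. -/
theorem exists_gap_of_isStandardSmooth {A B : Type u} [CommRing A] [CommRing B] [Algebra A B]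
    [Algebra.IsStandardSmooth A B] (f : B) {l : ℚ} (hl : 0 < l) :
    ∃ N : ℕ, ∀ (k R : Type u) [Field k] [CommRing R] [Algebra A k] [Algebra A R] [Algebra k R]
      [Algebra B R] [IsScalarTower A k R] [IsScalarTower A B R] [Algebra.IsPushout A k B R]
      (p : ℕ), p.Prime → (p : k) = 0 →
        IsNoetherianRing R ∧ HasCartierFamilies R p ∧
          ∀ μ : ℝ, IsRingJump p (algebraMap B R f) μ → μ < l → 1 / (p : ℝ) ^ N ≤ l - μ := by
  classical
  obtain ⟨σ, ι, _, _, ⟨P⟩⟩ := ‹Algebra.IsStandardSmooth A B›.out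
  obtain ⟨F, hF⟩ := P.algebraMap_surjective f
  -- The degrees are measured over A. Mapping coefficients to k cannot raise them, so d, and hence
  -- N, is independent of the fiber.
  set d := F.totalDegree + ∑ i, (P.relation i).totalDegree with hd
  refine ⟨2 * l.den + l.den.totient * (MvPolynomial.numMonomials σ d + 1), ?_⟩
  intro k R _ _ _ _ _ _ _ _ _ p hp hk
  let Q := P.toPreSubmersivePresentation.baseChange k
  let π : MvPolynomial σ k →ₐ[k] R :=
    (Algebra.IsPushout.equiv A k B R : TensorProduct A k B →ₐ[k] R).comp (MvPolynomial.aeval Q.val)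
  have hπ : Function.Surjective π :=
    (Algebra.IsPushout.equiv A k B R).surjective.comp Q.aeval_val_surjective
  have hker : RingHom.ker π = Ideal.span (Set.range Q.relation) := by
    rw [Q.span_range_relation_eq_ker, Q.ker_eq_ker_aeval_val]
    ext x
    simp [π, RingHom.mem_ker]
  have hjac : IsUnit (π (Matrix.of fun i j =>
      MvPolynomial.pderiv (Q.map i) (Q.relation j)).det) := by
    have h1 : (Matrix.of fun i j => MvPolynomial.pderiv (Q.map i) (Q.relation j)) =
        Q.jacobiMatrix := by
      ext1 i j
      rw [Q.jacobiMatrix_apply]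
      rfl
    have h2 : π Q.jacobiMatrix.det = Algebra.IsPushout.equiv A k B R Q.jacobian := by
      rw [Q.jacobian_eq_jacobiMatrix_det]
      rfl
    rw [h1, h2, Algebra.PreSubmersivePresentation.baseChange_jacobian]
    exact (P.jacobian_isUnit.map Algebra.TensorProduct.includeRight).map
      (Algebra.IsPushout.equiv A k B R)
  have hf : π (MvPolynomial.map (algebraMap A k) F) = algebraMap B R f := by
    have h1 : MvPolynomial.aeval Q.val (MvPolynomial.map (algebraMap A k) F) =
        (1 : k) ⊗ₜ[A] f := by
      rw [MvPolynomial.aeval_map_algebraMap, ← hF, P.algebraMap_apply]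
      apply MvPolynomial.aeval_one_tmul
    refine (congrArg (Algebra.IsPushout.equiv A k B R) h1).trans ?_
    rw [Algebra.IsPushout.equiv_tmul, map_one, one_mul]
  obtain ⟨Φ, hΦ, -⟩ := exists_isCartierFamily_of_jacobian hp hk hπ hker hjac
  refine ⟨isNoetherianRing_of_surjective _ _ π.toRingHom hπ, ⟨hp, ?_, Φ, hΦ⟩, fun μ hμ hμl => ?_⟩
  · rw [← map_natCast (algebraMap k R), hk, map_zero]
  · rw [← hf] at hμ
    refine hμ.gap_of_jacobian hp hk hπ hker hjac (d := d) ?_ hl hμl le_rfl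
    refine add_le_add (MvPolynomial.totalDegree_map_le _ _) (Finset.sum_le_sum fun i _ => ?_)
    exact MvPolynomial.totalDegree_map_le _ _

/-! ### Ideal sheaves -/

section Schemes

theorem resLE_appTop_topIso {X Y : Scheme.{u}} (f : X ⟶ Y) {U : Y.Opens} {V : X.Opens}
    (e : V ≤ f ⁻¹ᵁ U) :
    (f.resLE U V e).appTop ≫ V.topIso.hom = U.topIso.hom ≫ f.appLE U V e := by
  rw [Scheme.Hom.appTop, Scheme.Hom.resLE_app_top]
  simp only [Category.assoc, Iso.inv_hom_id, Category.comp_id]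

theorem ideal_eq_comap_of_eq {X : Scheme.{u}} (J : X.IdealSheafData) {V V' : X.affineOpens}
    (h : V = V') (i : V'.1 ⟶ V.1) :
    J.ideal V = (J.ideal V').comap (X.presheaf.map i.op).hom := by
  subst h
  have : i = 𝟙 _ := Subsingleton.elim _ _
  rw [this, op_id, CategoryTheory.Functor.map_id, CommRingCat.hom_id, Ideal.comap_id]

theorem ideal_comap_opens_ι {X : Scheme.{u}} (J : X.IdealSheafData) (U : X.affineOpens)
    (h : IsAffineOpen (⊤ : U.1.toScheme.Opens)) :
    (J.comap U.1.ι).ideal ⟨⊤, h⟩ = (J.ideal U).comap U.1.topIso.hom.hom := by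
  rw [Scheme.IdealSheafData.ideal_comap_of_isOpenImmersion, Scheme.Opens.ι_appIso]
  have h1 : U.1.ι ''ᵁ ⊤ = U.1 := by simp
  exact ideal_eq_comap_of_eq J (V := ⟨U.1.ι ''ᵁ ⊤, h.image_of_isOpenImmersion U.1.ι⟩)
    (Subtype.ext h1) (eqToHom h1.symm)

/-- Pulling back an ideal sheaf along an affine morphism extends its ideals of sections. -/
theorem ideal_comap_preimage {X Y : Scheme.{u}} (f : X ⟶ Y) [IsAffineHom f]
    (I : Y.IdealSheafData) (V : Y.affineOpens) :
    (I.comap f).ideal ⟨f ⁻¹ᵁ V.1, V.2.preimage f⟩ = (I.ideal V).map (f.app V.1).hom := by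
  -- Between affine schemes, the adjunction of `comap` and `map` reduces the inclusion to global
  -- sections. The general case restricts f to V and its preimage.
  have key : ∀ {X Y : Scheme.{u}} [IsAffine X] [IsAffine Y] (g : X ⟶ Y) (J : Y.IdealSheafData),
      (J.comap g).ideal ⟨⊤, isAffineOpen_top X⟩ ≤
        (J.ideal ⟨⊤, isAffineOpen_top Y⟩).map g.appTop.hom := by
    intro X Y _ _ g J
    have h1 : J.comap g ≤ Scheme.IdealSheafData.ofIdealTop
        ((J.ideal ⟨⊤, isAffineOpen_top Y⟩).map g.appTop.hom) := by
      rw [← Scheme.IdealSheafData.le_map_iff_comap_le]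
      refine Scheme.IdealSheafData.le_of_isAffine ?_
      rw [Scheme.IdealSheafData.ideal_map_of_isAffineHom, ← Ideal.map_le_iff_le_comap]
      exact le_of_eq (by simp [Scheme.Hom.appTop]; rfl)
    refine (h1 _).trans ?_
    simp
  apply le_antisymm
  · let W : X.affineOpens := ⟨f ⁻¹ᵁ V.1, V.2.preimage f⟩
    have : IsAffine V.1 := V.2
    have : IsAffine W.1 := W.2
    have h1 := key (f.resLE V.1 W.1 le_rfl) (I.comap V.1.ι)
    rw [← Scheme.IdealSheafData.comap_comp, Scheme.Hom.resLE_comp_ι,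
      Scheme.IdealSheafData.comap_comp] at h1
    have h2 := (ideal_comap_opens_ι (I.comap f) W (isAffineOpen_top _)).ge.trans h1
    have h3 := ideal_comap_opens_ι I V (isAffineOpen_top _)
    intro x hx
    obtain ⟨y, rfl⟩ : ∃ y, W.1.topIso.hom.hom y = x :=
      ⟨W.1.topIso.inv.hom x, by rw [← CommRingCat.comp_apply, Iso.inv_hom_id]; rfl⟩
    have h4 := Ideal.mem_map_of_mem W.1.topIso.hom.hom (h2 hx)
    rw [Ideal.map_map, ← CommRingCat.hom_comp, resLE_appTop_topIso, CommRingCat.hom_comp,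
      ← Ideal.map_map, Scheme.Hom.appLE_eq_app] at h4
    refine Ideal.map_mono ?_ h4
    rw [h3]
    exact Ideal.map_comap_le
  · rw [Ideal.map_le_iff_le_comap, ← Scheme.IdealSheafData.ideal_map_of_isAffineHom]
    exact Scheme.IdealSheafData.le_map_comap I f V


/-- On affine charts, the sections of the fiber over `s` are the base change to the residue field. -/
theorem isPushout_fiber {X S : Scheme.{u}} (π : X ⟶ S) (s : S)
    [IsAffineHom (S.fromSpecResidueField s)] {U : S.Opens} (hU : IsAffineOpen U)
    (hs : s ∈ U) {V : X.Opens} (hV : IsAffineOpen V) (e : V ≤ π ⁻¹ᵁ U) :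
    ∃ (a : Γ(S, U) ⟶ S.residueField s) (b : S.residueField s ⟶ Γ(π.fiber s, π.fiberι s ⁻¹ᵁ V)),
      IsPushout (π.appLE U V e) a ((π.fiberι s).app V) b := by
  have hUs : (⊤ : (Spec (S.residueField s)).Opens) ≤ S.fromSpecResidueField s ⁻¹ᵁ U := by
    intro x _
    have : S.fromSpecResidueField s x ∈ Set.range (S.fromSpecResidueField s) := ⟨x, rfl⟩
    rw [Scheme.range_fromSpecResidueField] at this
    rw [Set.mem_singleton_iff] at this
    simpa [this] using hs
  have H : IsPullback (π.fiberι s) (π.fiberToSpecResidueField s) π (S.fromSpecResidueField s) :=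
    IsPullback.of_hasPullback _ _
  have H' := Scheme.Hom.isPullback_resLE H hUs e (UY := π.fiberι s ⁻¹ᵁ V) (by simp)
  have : IsAffine U := hU
  have : IsAffine V := hV
  have : IsAffine (⊤ : (Spec (S.residueField s)).Opens) := isAffineOpen_top _
  have H'' := isPushout_appTop_of_isPullback H'
  refine ⟨(S.fromSpecResidueField s).appLE U ⊤ hUs ≫ (Scheme.ΓSpecIso _).hom,
    (Scheme.ΓSpecIso _).inv ≫ (π.fiberToSpecResidueField s).appLE ⊤ _ (by simp), ?_⟩
  refine IsPushout.of_iso H'' U.topIso V.topIso ((⊤ : (Spec (S.residueField s)).Opens).topIso ≪≫ Scheme.ΓSpecIso _)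
    (Scheme.Opens.topIso _) ?_ ?_ ?_ ?_
  · exact resLE_appTop_topIso _ _
  · rw [Iso.trans_hom, ← Category.assoc, resLE_appTop_topIso, Category.assoc]
  · rw [resLE_appTop_topIso, Scheme.Hom.appLE_eq_app]
  · rw [resLE_appTop_topIso, Iso.trans_hom, Category.assoc, Iso.hom_inv_id_assoc]

end Schemes

/-! ### Test ideals and jumping numbers on affine covers -/

section Schemes

/-- Two test ideals on a scheme agree on all affine open subsets if they agree on an affine cover
by spectra of Noetherian rings with Cartier families. -/
theorem testIdeal_eq_of_iSup_eq_top {Y : Scheme.{u}} {p : ℕ} (hp : p.Prime)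
    (hY : ∀ U : Y.Opens, (p : Γ(Y, U)) = 0) {𝔞 : Y.IdealSheafData} {ι : Type*}
    {W : ι → Y.affineOpens} (hW : ∀ y : Y, ∃ i, y ∈ (W i).1)
    (hN : ∀ i, IsNoetherianRing Γ(Y, (W i).1)) (hΦ : ∀ i, HasCartierFamilies Γ(Y, (W i).1) p)
    {f : ∀ i, Γ(Y, (W i).1)} (hf : ∀ i, 𝔞.ideal (W i) = Ideal.span {f i}) {s t : ℝ}
    (hst : ∀ i, ringTestIdeal p (Ideal.span {f i}) s = ringTestIdeal p (Ideal.span {f i}) t) :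
    testIdeal p 𝔞 s = testIdeal p 𝔞 t := by
  refine congrArg Scheme.IdealSheafData.ofIdeals (funext fun U => ?_)
  -- Open sets that are basic both in U and in a member of the cover: test ideals can be compared
  -- there, and they cover U.
  let T : Set Γ(Y, U.1) := {h | ∃ i, ∃ g : Γ(Y, (W i).1), Y.basicOpen h = Y.basicOpen g}
  have hT : Ideal.span T = ⊤ := by
    rw [← IsAffineOpen.self_le_iSup_basicOpen_iff (show IsAffineOpen U.1 from U.2)]
    intro y hy
    obtain ⟨i, hi⟩ := hW y
    obtain ⟨h, g, hhg, hyh⟩ := exists_basicOpen_le_affine_inter U.2 (W i).2 y ⟨hy, hi⟩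
    exact TopologicalSpace.Opens.mem_iSup.mpr ⟨⟨h, i, g, hhg⟩, hyh⟩
  obtain ⟨T', hT', hspan⟩ := (Ideal.span_eq_top_iff_finite T).mp hT
  choose i g hg using fun h : T' => hT' h.2
  let _ (h : T') : Algebra Γ(Y, U.1) Γ(Y, Y.basicOpen h.1) :=
    (Y.presheaf.map (homOfLE (Y.basicOpen_le h.1)).op).hom.toAlgebra
  have (h : T') : IsLocalization.Away h.1 Γ(Y, Y.basicOpen h.1) :=
    U.2.isLocalization_of_eq_basicOpen h.1 (homOfLE (Y.basicOpen_le h.1)) rfl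
  have hle (h : T') : Y.basicOpen h.1 ≤ (W (i h)).1 := (hg h).le.trans (Y.basicOpen_le _)
  let _ (h : T') : Algebra Γ(Y, (W (i h)).1) Γ(Y, Y.basicOpen h.1) :=
    (Y.presheaf.map (homOfLE (hle h)).op).hom.toAlgebra
  have (h : T') : IsLocalization.Away (g h) Γ(Y, Y.basicOpen h.1) :=
    (W (i h)).2.isLocalization_of_eq_basicOpen (g h) (homOfLE (hle h)) (hg h)
  have (h : T') : IsNoetherianRing Γ(Y, (W (i h)).1) := hN _
  refine ringTestIdeal_eq_of_cover hp (hY U.1) (h := fun h : T' => h.1) (by simpa using hspan)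
    (S := fun h : T' => Γ(Y, Y.basicOpen h.1)) (T := fun h : T' => Γ(Y, (W (i h)).1)) (g := g)
    (fun h => hΦ _) (f := fun h => f (i h)) (fun h => ?_) fun h => hst _
  rw [← hf]
  exact (𝔞.map_ideal (U := ⟨Y.basicOpen h.1, U.2.basicOpen h.1⟩) (V := U) (Y.basicOpen_le h.1)).trans
    (𝔞.map_ideal (U := ⟨Y.basicOpen h.1, U.2.basicOpen h.1⟩) (V := W (i h)) (hle h)).symm

/-- A jumping number of an ideal sheaf is a jumping number on some member of an affine cover. -/
theorem IsFJumpingNumber.exists_isRingJump {Y : Scheme.{u}} {p : ℕ} (hp : p.Prime)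
    (hY : ∀ U : Y.Opens, (p : Γ(Y, U)) = 0) {𝔞 : Y.IdealSheafData} {ι : Type*} [Finite ι]
    {W : ι → Y.affineOpens} (hW : ∀ y : Y, ∃ i, y ∈ (W i).1)
    (hN : ∀ i, IsNoetherianRing Γ(Y, (W i).1)) (hΦ : ∀ i, HasCartierFamilies Γ(Y, (W i).1) p)
    {f : ∀ i, Γ(Y, (W i).1)} (hf : ∀ i, 𝔞.ideal (W i) = Ideal.span {f i}) {t : ℝ}
    (ht : IsFJumpingNumber p 𝔞 t) : ∃ i, IsRingJump p (f i) t := by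
  by_contra! hcon
  have h1 : ∀ i, ∃ μ : ℝ, 0 ≤ μ ∧ μ < t ∧
      ringTestIdeal p (Ideal.span {f i}) t = ringTestIdeal p (Ideal.span {f i}) μ := by
    intro i
    have := hcon i
    unfold IsRingJump at this
    push Not at this
    exact this ht.1
  choose μ hμ0 hμt hμ using h1
  -- A common exponent below t exists because the cover is finite; monotonicity then makes the test
  -- ideal constant on [ν, t] in every chart.
  obtain ⟨ν, hν0, hνt, hν⟩ : ∃ ν : ℝ, 0 ≤ ν ∧ ν < t ∧ ∀ i, μ i ≤ ν := by
    rcases isEmpty_or_nonempty ι with h | h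
    · exact ⟨0, le_rfl, ht.1, fun i => isEmptyElim i⟩
    · obtain ⟨j, hj⟩ := Finite.exists_max μ
      exact ⟨μ j, hμ0 j, hμt j, hj⟩
  refine ht.2 ν hν0 hνt (testIdeal_eq_of_iSup_eq_top hp hY hW hN hΦ hf fun i => ?_)
  have := hN i
  refine le_antisymm ((hΦ i).ringTestIdeal_antitone _ hνt.le) ?_
  rw [hμ i]
  exact (hΦ i).ringTestIdeal_antitone _ (hν i)

/-- Around every point, a smooth morphism with a locally principal ideal sheaf is standard smooth
with principal ideal. -/
theorem exists_isStandardSmooth_isPrincipal {X S : Scheme.{u}} (π : X ⟶ S) [Smooth π]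
    {𝔞 : X.IdealSheafData} (h𝔞 : IsLocallyPrincipal 𝔞) (x : X) :
    ∃ (U : S.affineOpens) (V : X.affineOpens) (e : V.1 ≤ π ⁻¹ᵁ U.1), x ∈ V.1 ∧
      (π.appLE U.1 V.1 e).hom.IsStandardSmooth ∧ (𝔞.ideal V).IsPrincipal := by
  obtain ⟨U, hU, V, hV, hx, e, hsm⟩ := Smooth.exists_isStandardSmooth π x
  obtain ⟨W, hxW, hW⟩ := h𝔞 x
  obtain ⟨h, g, hhg, hxh⟩ := exists_basicOpen_le_affine_inter hV W.2 x ⟨hx, hxW⟩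
  let V' : X.affineOpens := ⟨X.basicOpen h, hV.basicOpen h⟩
  have hV'V : V'.1 ≤ V := X.basicOpen_le h
  have hV'W : V' ≤ W := hhg.le.trans (X.basicOpen_le g)
  refine ⟨⟨U, hU⟩, V', hV'V.trans e, hxh, ?_, ?_⟩
  · have h1 : π.appLE U V'.1 (hV'V.trans e) =
        π.appLE U V e ≫ X.presheaf.map (homOfLE hV'V).op := by
      rw [Scheme.Hom.appLE_map]
    change (π.appLE U V'.1 (hV'V.trans e)).hom.IsStandardSmooth
    rw [h1, CommRingCat.hom_comp]
    refine RingHom.IsStandardSmooth.comp ?_ hsm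
    have := hV.isLocalization_of_eq_basicOpen h (homOfLE hV'V) rfl
    exact Algebra.IsStandardSmooth.localization_away h
  · rw [← 𝔞.map_ideal hV'W]
    obtain ⟨⟨f, hf⟩⟩ := hW
    rw [hf, Ideal.submodule_span_eq, Ideal.map_span, Set.image_singleton]
    exact ⟨⟨_, rfl⟩⟩

theorem isAffineHom_fiberι {X S : Scheme.{u}} (π : X ⟶ S) (s : S)
    [IsAffineHom (S.fromSpecResidueField s)] : IsAffineHom (π.fiberι s) :=
  MorphismProperty.of_isPullback (P := @IsAffineHom)
    (show IsPullback (π.fiberToSpecResidueField s) (π.fiberι s) (S.fromSpecResidueField s) π from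
      (IsPullback.of_hasPullback π (S.fromSpecResidueField s)).flip) ‹_›

/-- The gap below `l` in the fibers of one chart. -/
theorem exists_gap_chart {X S : Scheme.{u}} (π : X ⟶ S)
    (𝔞 : X.IdealSheafData) (hS : ∀ s : S, IsAffineHom (S.fromSpecResidueField s))
    {U : S.affineOpens} {V : X.affineOpens} (e : V.1 ≤ π ⁻¹ᵁ U.1)
    (hsm : (π.appLE U.1 V.1 e).hom.IsStandardSmooth) (hpr : (𝔞.ideal V).IsPrincipal)
    {l : ℚ} (hl : 0 < l) :
    ∃ N : ℕ, ∀ s ∈ U.1, (residueChar s).Prime →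
      IsNoetherianRing Γ(π.fiber s, π.fiberι s ⁻¹ᵁ V.1) ∧
      HasCartierFamilies Γ(π.fiber s, π.fiberι s ⁻¹ᵁ V.1) (residueChar s) ∧
      ∃ f : Γ(π.fiber s, π.fiberι s ⁻¹ᵁ V.1),
        (∀ h : IsAffineOpen (π.fiberι s ⁻¹ᵁ V.1),
          (fiberIdeal π 𝔞 s).ideal ⟨π.fiberι s ⁻¹ᵁ V.1, h⟩ = Ideal.span {f}) ∧
        ∀ μ : ℝ, IsRingJump (residueChar s) f μ → μ < l →
          1 / (residueChar s : ℝ) ^ N ≤ l - μ := by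
  obtain ⟨⟨f, hf⟩⟩ := hpr
  algebraize [(π.appLE U.1 V.1 e).hom]
  obtain ⟨N, hN⟩ := exists_gap_of_isStandardSmooth (A := Γ(S, U.1)) f hl
  refine ⟨N, fun s hs hp => ?_⟩
  have := hS s
  obtain ⟨a, b, hab⟩ := isPushout_fiber π s U.2 hs V.2 e
  have := isAffineHom_fiberι π s
  let _ : Field (S.residueField s) := inferInstance
  algebraize [a.hom, b.hom, ((π.fiberι s).app V.1).hom, b.hom.comp a.hom]
  have : IsScalarTower Γ(S, U.1) Γ(X, V.1) Γ(π.fiber s, π.fiberι s ⁻¹ᵁ V.1) :=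
    .of_algebraMap_eq' (congrArg CommRingCat.Hom.hom hab.w).symm
  have : Algebra.IsPushout Γ(S, U.1) (S.residueField s) Γ(X, V.1)
      Γ(π.fiber s, π.fiberι s ⁻¹ᵁ V.1) :=
    CommRingCat.isPushout_iff_isPushout.mp hab.flip
  have hk : (residueChar s : S.residueField s) = 0 := ringChar.Nat.cast_ringChar
  obtain ⟨h1, h2, h3⟩ := hN (S.residueField s) Γ(π.fiber s, π.fiberι s ⁻¹ᵁ V.1) _ hp hk
  refine ⟨h1, h2, _, fun h => ?_, h3⟩
  refine (ideal_comap_preimage (π.fiberι s) 𝔞 V).trans ?_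
  rw [hf, Ideal.submodule_span_eq, Ideal.map_span, Set.image_singleton]
  rfl

end Schemes

/-! ### From charts to the whole family -/

theorem theorem3p3 (l : ℚ) (hl : 0 < l) :
    ∃ p₀ : ℕ, 0 < p₀ ∧
      ∀ (A : Type u) [CommRing A] [Nontrivial A] [Algebra.FiniteType ℤ A]
        (n : ℕ) (X : Scheme.{u}) (π : X ⟶ Spec (CommRingCat.of A))
        [QuasiCompact π] [LocallyOfFiniteType π] [SmoothOfRelativeDimension n π]
        (𝔞 : X.IdealSheafData),
        IsLocallyPrincipal 𝔞 →
        (∀ s : Spec (CommRingCat.of A), IsEverywhereNonzero (fiberIdeal π 𝔞 s)) →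
        ∃ N : ℕ, 0 < N ∧
          (∀ s : Spec (CommRingCat.of A), IsClosed {s} → p₀ < residueChar s →
            JumpingGapAt π 𝔞 (l : ℝ) N s) ∧
          (∃ a : A, ¬ IsNilpotent a ∧
            ∀ t : Spec (CommRingCat.of (Localization.Away a)), IsClosed {t} →
              JumpingGapAt π 𝔞 (l : ℝ) N
                (Spec.map (CommRingCat.ofHom (algebraMap A (Localization.Away a))) t)) := by
  -- The argument works in every positive characteristic, so p₀ = 1 is enough, and a = 1 serves in
  -- the second part.
  refine ⟨1, one_pos, fun A _ _ _ n X π _ _ _ 𝔞 h𝔞 _ => ?_⟩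
  suffices h : ∃ N : ℕ, 0 < N ∧ ∀ s, JumpingGapAt π 𝔞 (l : ℝ) N s by
    obtain ⟨N, hN, h⟩ := h
    exact ⟨N, hN, fun s _ _ => h s, 1, not_isNilpotent_one, fun t _ => h _⟩
  have : Smooth π := SmoothOfRelativeDimension.smooth n π
  have hS : ∀ s : Spec (CommRingCat.of A), IsAffineHom ((Spec (CommRingCat.of A)).fromSpecResidueField s) :=
    fun s => inferInstance
  have : CompactSpace X := QuasiCompact.compactSpace_of_compactSpace π
  choose U V e hx hsm hpr using exists_isStandardSmooth_isPrincipal π h𝔞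
  choose M hM using fun x => exists_gap_chart π 𝔞 hS (e x) (hsm x) (hpr x) hl
  obtain ⟨T, hT⟩ := isCompact_univ.elim_finite_subcover (fun x => ((V x).1 : Set X))
    (fun x => (V x).1.isOpen) fun x _ => Set.mem_iUnion.mpr ⟨x, hx x⟩
  -- The summand 1 keeps N positive; in residue characteristic 0 this makes 1/0^N equal to 0.
  refine ⟨T.sup M + 1, Nat.succ_pos _, fun s μ hμ hμl => ?_⟩
  have hk : (residueChar s : (Spec (CommRingCat.of A)).residueField s) = 0 :=
    ringChar.Nat.cast_ringChar
  rcases CharP.char_is_prime_or_zero ((Spec (CommRingCat.of A)).residueField s) (residueChar s)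
    with hp | hp
  swap
  · -- closed points have positive characteristic; at the other points nothing is claimed
    rw [hp]
    simp [hμl.le]
  have := isAffineHom_fiberι π s
  -- Only charts whose base open set contains s are kept; the others do not meet the fiber.
  let T' := {x : T // s ∈ (U x.1).1}
  let W : T' → (π.fiber s).affineOpens := fun x =>
    ⟨π.fiberι s ⁻¹ᵁ (V x.1.1).1, (V x.1.1).2.preimage _⟩
  choose hNoeth hΦ f hf hgap using fun x : T' => hM x.1.1 s x.2 hp
  have hY : ∀ O : (π.fiber s).Opens, (residueChar s : Γ(π.fiber s, O)) = 0 := by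
    intro O
    let φ := (Scheme.ΓSpecIso _).inv ≫ (π.fiberToSpecResidueField s).appLE ⊤ O le_top
    rw [← map_natCast φ.hom, hk, map_zero]
  have hW : ∀ y : π.fiber s, ∃ i, y ∈ (W i).1 := by
    intro y
    obtain ⟨x, hxT, hxV⟩ := Set.mem_iUnion₂.mp (hT (Set.mem_univ (π.fiberι s y)))
    refine ⟨⟨⟨x, hxT⟩, ?_⟩, hxV⟩
    have h1 : π (π.fiberι s y) ∈ (U x).1 := e x hxV
    have h2 : π (π.fiberι s y) = s := by
      have : π.fiberι s y ∈ Set.range (π.fiberι s) := ⟨y, rfl⟩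
      rw [Scheme.Hom.range_fiberι] at this
      exact this
    rwa [h2] at h1
  obtain ⟨i, hi⟩ := hμ.exists_isRingJump hp hY hW hNoeth hΦ fun i => hf i (W i).2
  refine le_trans ?_ (hgap i μ hi hμl)
  have h1 : (1 : ℝ) ≤ residueChar s := by exact_mod_cast hp.one_le
  refine one_div_le_one_div_of_le (by positivity) (pow_le_pow_right₀ h1 ?_)
  exact (Finset.le_sup i.1.2).trans (Nat.le_succ _)
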